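/- For $\alpha\in\mathbb{R}$ and $\omega>0$ put $$\beta_\alpha(\omega)=\alpha+\frac{\gamma}{2\pi}+\frac1{2\pi}\ln\frac{\sqrt\omega}{2},\qquad e_\alpha=-4e^{-2(2\pi\alpha+\gamma)},$$ where $\gamma$ is the Euler–Mascheroni constant, and let $\mathcal G_\omega\in L^2(\mathbb{R}^2)$ be the Green function of $\omega-\Delta$, i.e. $\mathcal G_\omega(x)=(2\pi)^{-2}\int_{\mathbb{R}^2}e^{-\mathrm{i}x\cdot k}(\omega+|k|^2)^{-1}\,\mathrm{d}k$ in the sense of the Fourier transform on $L^2$. Fix any $\omega_0>0$ with $\beta_\alpha(\omega_0)\neq0$ (that is, $\omega_0\ne -e_\alpha$), and let $-\Delta_\alpha$ be the self-adjoint operator on $L^2(\mathbb{R}^2)$ (which does not depend on $\omega_0$) with $$\mathcal D(-\Delta_\alpha)=\Big\{g=f+\frac{f(0)}{\beta_\alpha(\omega_0)}\,\mathcal G_{\omega_0}\ \Big|\ f\in H^2(\mathbb{R}^2)\Big\},\qquad (\omega_0-\Delta_\alpha)\,g=(\omega_0-\Delta)f,$$ where $f(0)$ is the value at $0$ of the continuous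 representative of $f$. For $\omega>|e_\alpha|$ the operator $\omega-\Delta_\alpha$ is positive with bounded inverse; for $s\in[0,1)$ set $$H^s_\alpha(\mathbb{R}^2)=\mathcal D\big((\omega-\Delta_\alpha)^{s/2}\big)=\big\{(\omega-\Delta_\alpha)^{-s/2}h\ \big|\ h\in L^2(\mathbb{R}^2)\big\},\qquad \|g\|_{H^s_\alpha}=\|(\omega-\Delta_\alpha)^{s/2}g\|_{L^2}.$$ Then for every $\alpha\in\mathbb{R}$, every $s\in[0,1)$ and every $\omega>|e_\alpha|$, $$H^s_\alpha(\mathbb{R}^2)=H^s(\mathbb{R}^2)$$ as spaces of tempered distributions, with equivalent norms: there are constants $c,C>0$ such that $c\,\|g\|_{H^s}\le\|g\|_{H^s_\alpha}\le C\,\|g\|_{H^s}$ for all $g\in H^s(\mathbb{R}^2)$, where $\|g\|_{H^s}^2=\int_{\mathbb{R}^2}(1+|k|^2)^s|\widehat g(k)|^2\,\mathrm{d}k$ with the unitary Fourier transform $\widehat g$. -/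

import Mathlib

open MeasureTheory TemperedDistribution
open scoped SchwartzMap FourierTransform Laplacian

noncomputable section

set_option linter.unusedSectionVars false

/-! ### Real powers of unbounded operators -/

namespace LinearPMap

variable {H : Type*} [NormedAddCommGroup H] [InnerProductSpace ℂ H] [CompleteSpace H]

/-- `R` is the everywhere defined bounded inverse of the unbounded operator `A`, i.e. `A` is a
bijection of its domain onto `H`, with inverse `R`. -/
def IsBoundedInverse (A : H →ₗ.[ℂ] H) (R : H →L[ℂ] H) : Prop :=
  ∀ x y : H, (x, y) ∈ A.graph ↔ x = R y

open Classical in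
/-- The bounded inverse `A⁻¹` (zero if there is none). -/
def boundedInverse (A : H →ₗ.[ℂ] H) : H →L[ℂ] H :=
  if h : ∃ R, A.IsBoundedInverse R then h.choose else 0

theorem IsBoundedInverse.unique {A : H →ₗ.[ℂ] H} {R S : H →L[ℂ] H}
    (hR : A.IsBoundedInverse R) (hS : A.IsBoundedInverse S) : R = S :=
  ContinuousLinearMap.ext fun y => (hS _ _).1 ((hR (R y) y).2 rfl)

theorem IsBoundedInverse.boundedInverse_eq {A : H →ₗ.[ℂ] H} {R : H →L[ℂ] H}
    (hR : A.IsBoundedInverse R) : A.boundedInverse = R := by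
  have h : ∃ R, A.IsBoundedInverse R := ⟨R, hR⟩
  rw [boundedInverse, dif_pos h]
  exact h.choose_spec.unique hR

/-- The power `A ^ (-σ)`, `0 ≤ σ`, of a positive self-adjoint operator `A` with bounded inverse.
The function `a ↦ a ^ (-σ)` of `A` is the function `t ↦ t ^ σ` of the bounded positive operator
`A⁻¹`; the latter is taken in the sense of the continuous functional calculus. -/
def negPow (A : H →ₗ.[ℂ] H) (σ : ℝ) : H →L[ℂ] H :=
  A.boundedInverse ^ σ

/-- The power `A ^ σ`, `0 ≤ σ`, of a positive self-adjoint operator `A` with bounded inverse: the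
(in general unbounded) inverse of the injective operator `A ^ (-σ)`. Its domain is the range of
`A ^ (-σ)`. -/
def fracPow (A : H →ₗ.[ℂ] H) (σ : ℝ) : H →ₗ.[ℂ] H :=
  ((A.negPow σ : H →ₗ[ℂ] H).toPMap ⊤).inverse

theorem mem_fracPow_domain_iff (A : H →ₗ.[ℂ] H) (σ : ℝ) (g : H) :
    g ∈ (A.fracPow σ).domain ↔ ∃ h : H, A.negPow σ h = g := by
  rw [fracPow, LinearPMap.inverse_domain]
  simp [LinearMap.mem_range, LinearMap.toPMap]

end LinearPMap

/-! ### The point interaction in the plane -/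

namespace PointInteraction

/-- The Euclidean plane. -/
abbrev Plane : Type := EuclideanSpace ℝ (Fin 2)

/-- The Hilbert space `L²(ℝ²; ℂ)`. -/
abbrev L2 : Type := Lp ℂ 2 (volume : Measure Plane)

/-- The symbol `1 / (ω + |k|²)` of `(ω - Δ)⁻¹`, in the variable `ξ = k / (2π)` of the Fourier
transform `𝓕 f ξ = ∫ exp (-2πi⟨x, ξ⟩) f x dx`. -/
def greenSymbol (ω : ℝ) (ξ : Plane) : ℂ :=
  ((ω + (2 * Real.pi * ‖ξ‖) ^ 2)⁻¹ : ℝ)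

theorem memLp_greenSymbol {ω : ℝ} (hω : 0 < ω) : MemLp (greenSymbol ω) 2 volume := by
  have hm : Measurable (greenSymbol ω) := by
    unfold greenSymbol
    fun_prop
  rw [memLp_two_iff_integrable_sq_norm hm.aestronglyMeasurable]
  have hpi : 0 < (2 * Real.pi) ^ 2 := by positivity
  have hi : Integrable (fun x : Plane ↦ ((1 : ℝ) + ‖x‖ ^ 2) ^ (-(4 : ℝ) / 2)) volume :=
    integrable_rpow_neg_one_add_norm_sq (by simp; norm_num)
  set m : ℝ := min ω ((2 * Real.pi) ^ 2) with hmdef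
  have hm0 : 0 < m := lt_min hω hpi
  refine (hi.const_mul (m⁻¹ ^ 2)).mono' (hm.norm.pow_const 2).aestronglyMeasurable
    (Filter.Eventually.of_forall fun x => ?_)
  have h1 : (0 : ℝ) < 1 + ‖x‖ ^ 2 := by positivity
  have h2 : ((1 : ℝ) + ‖x‖ ^ 2) ^ (-(4 : ℝ) / 2) = ((1 + ‖x‖ ^ 2)⁻¹) ^ 2 := by
    rw [show (-(4 : ℝ) / 2) = -((2 : ℕ) : ℝ) by norm_num, Real.rpow_neg h1.le,
      Real.rpow_natCast, inv_pow]
  have h3 : m * (1 + ‖x‖ ^ 2) ≤ ω + (2 * Real.pi * ‖x‖) ^ 2 := by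
    have ha : m ≤ ω := min_le_left _ _
    have hb : m ≤ (2 * Real.pi) ^ 2 := min_le_right _ _
    have hc := mul_le_mul_of_nonneg_right hb (sq_nonneg ‖x‖)
    rw [mul_pow]
    linarith
  have h4 : 0 < ω + (2 * Real.pi * ‖x‖) ^ 2 := by positivity
  have h5 : ‖greenSymbol ω x‖ = (ω + (2 * Real.pi * ‖x‖) ^ 2)⁻¹ := by
    rw [greenSymbol, Complex.norm_real, Real.norm_eq_abs, abs_of_pos (inv_pos.2 h4)]
  rw [norm_pow, norm_norm, h5, h2, ← mul_pow, ← mul_inv]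
  gcongr

/-- The Green function `𝒢_ω`, the inverse Fourier transform of `1 / (ω + |k|²)`, that is
`(2π)⁻² ∫ exp (-i x·k) / (ω + |k|²) dk`. The integral does not converge absolutely in two
dimensions and is understood as the Fourier transform of `L²` functions. -/
def greenFunction (ω : ℝ) (hω : 0 < ω) : L2 :=
  𝓕⁻ ((memLp_greenSymbol hω).toLp (greenSymbol ω))

/-- `β_α(ω) = α + γ / (2π) + log (√ω / 2) / (2π)`. -/
def beta (α ω : ℝ) : ℝ :=
  α + Real.eulerMascheroniConstant / (2 * Real.pi)
    + 1 / (2 * Real.pi) * Real.log (Real.sqrt ω / 2)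

/-- The negative eigenvalue `e_α = -4 exp (-2 (2πα + γ))` of `-Δ_α`. -/
def eigenvalue (α : ℝ) : ℝ :=
  -4 * Real.exp (-2 * (2 * Real.pi * α + Real.eulerMascheroniConstant))

/-- The graph of `-Δ_α`: the pairs `(g, k)` such that `g = f + (f(0) / β_α(ω)) 𝒢_ω` and
`k + ω g = (ω - Δ) f` for some `f ∈ H²(ℝ²)`. Here `f(0)` is the value at `0` of the continuous
representative `F` of `f`, and `Δ` is the distributional Laplacian. -/
def graph (α ω : ℝ) (hω : 0 < ω) : Submodule ℂ (L2 × L2) where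
  carrier := {p | ∃ (f : L2) (F : Plane → ℂ),
    MemSobolev 2 2 (f : 𝓢'(Plane, ℂ)) ∧ Continuous F ∧ f =ᵐ[volume] F ∧
    p.1 = f + (F 0 / (beta α ω : ℂ)) • greenFunction ω hω ∧
    ((p.2 + (ω : ℂ) • p.1 : L2) : 𝓢'(Plane, ℂ)) =
      (ω : ℂ) • (f : 𝓢'(Plane, ℂ)) - Δ (f : 𝓢'(Plane, ℂ))}
  add_mem' := by
    rintro p q ⟨f, F, hf, hF, hfF, h1, h2⟩ ⟨f', F', hf', hF', hfF', h1', h2'⟩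
    refine ⟨f + f', F + F', ?_, hF.add hF', (Lp.coeFn_add f f').trans (hfF.add hfF'), ?_, ?_⟩
    · have := hf.add hf'
      simpa only [← Lp.toTemperedDistributionCLM_apply, map_add] using this
    · rw [Prod.fst_add, h1, h1', Pi.add_apply, add_div, add_smul]
      abel
    · have e : (p + q).2 + (ω : ℂ) • (p + q).1
          = (p.2 + (ω : ℂ) • p.1) + (q.2 + (ω : ℂ) • q.1) := by
        rw [Prod.fst_add, Prod.snd_add, smul_add]
        abel
      rw [e]
      simp only [← Lp.toTemperedDistributionCLM_apply, ← laplacianCLM_apply] at h2 h2' ⊢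
      rw [map_add, h2, h2']
      simp only [map_add, smul_add]
      abel
  zero_mem' := by
    refine ⟨0, 0, ?_, continuous_zero, Lp.coeFn_zero _ _ _, ?_, ?_⟩
    · simpa only [← Lp.toTemperedDistributionCLM_apply, map_zero] using
        memSobolev_fun_zero Plane ℂ 2 2
    · simp
    · simp only [← Lp.toTemperedDistributionCLM_apply, ← laplacianCLM_apply, Prod.fst_zero,
        Prod.snd_zero, smul_zero, add_zero, map_zero, sub_zero]
  smul_mem' := by
    rintro a p ⟨f, F, hf, hF, hfF, h1, h2⟩
    refine ⟨a • f, a • F, ?_, hF.const_smul a,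
      (Lp.coeFn_smul a f).trans (hfF.const_smul a), ?_, ?_⟩
    · have := hf.smul a
      simpa only [← Lp.toTemperedDistributionCLM_apply, map_smul] using this
    · rw [Prod.smul_fst, h1, Pi.smul_apply, smul_eq_mul, mul_div_assoc, mul_smul, smul_add]
    · have e : (a • p).2 + (ω : ℂ) • (a • p).1 = a • (p.2 + (ω : ℂ) • p.1) := by
        rw [Prod.smul_fst, Prod.smul_snd, smul_add, smul_comm a (ω : ℂ)]
      rw [e]
      simp only [← Lp.toTemperedDistributionCLM_apply, ← laplacianCLM_apply] at h2 ⊢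
      rw [map_smul, h2]
      simp only [map_smul, smul_sub]
      rw [smul_comm a (ω : ℂ)]

/-- The operator `-Δ_α` in `L²(ℝ²)`. The number `ω` is the auxiliary constant that enters the
description of its domain. -/
def negLaplacian (α ω : ℝ) (hω : 0 < ω) : L2 →ₗ.[ℂ] L2 :=
  (graph α ω hω).toLinearPMap

/-- The relation above is the graph of an operator: `g` determines `k`. -/
theorem graph_snd_eq_zero {α ω : ℝ} (hω : 0 < ω) (p : L2 × L2)
    (hp : p ∈ graph α ω hω) (hp0 : p.1 = 0) : p.2 = 0 := by
  obtain ⟨f, F, -, -, -, h1, h2⟩ := hp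
  rw [hp0] at h1
  rw [hp0, smul_zero, add_zero] at h2
  set c : ℂ := F 0 / (beta α ω : ℂ) with hc
  have hf : f = (-c) • greenFunction ω hω := by
    rw [neg_smul]
    exact eq_neg_of_add_eq_zero_left h1.symm
  have hFf : (𝓕 f : L2) = (-c) • (memLp_greenSymbol hω).toLp (greenSymbol ω) := by
    rw [hf, FourierTransform.fourier_smul, greenFunction, FourierTransform.fourier_fourierInv_eq]
  have ht : (fun x : Plane ↦ ((‖x‖ ^ 2 : ℝ) : ℂ)).HasTemperateGrowth := by fun_prop
  have key : ∀ φ : 𝓢(Plane, ℂ), ∫ x, φ x • (𝓕 p.2 : L2) x = ∫ x, φ x • (-c) := by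
    intro φ
    have e1 : 𝓕 (p.2 : 𝓢'(Plane, ℂ)) = (ω : ℂ) • 𝓕 (f : 𝓢'(Plane, ℂ)) +
        (((2 * Real.pi) ^ 2 : ℝ) : ℂ) • smulLeftCLM ℂ (fun x : Plane ↦ ((‖x‖ ^ 2 : ℝ) : ℂ))
          (𝓕 (f : 𝓢'(Plane, ℂ))) := by
      rw [h2, laplacian_eq_fourierMultiplierCLM, fourierMultiplierCLM_apply, sub_eq_add_neg,
        ← neg_smul, FourierTransform.fourier_add, FourierTransform.fourier_smul,
        ← Complex.coe_smul, FourierTransform.fourier_smul, FourierTransform.fourier_fourierInv_eq,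
        neg_neg]
    rw [Lp.fourier_toTemperedDistribution_eq, Lp.fourier_toTemperedDistribution_eq] at e1
    have e2 : (Lp.toTemperedDistribution (𝓕 p.2 : L2) : 𝓢'(Plane, ℂ)) φ =
        (Lp.toTemperedDistribution (𝓕 f : L2) : 𝓢'(Plane, ℂ)) ((ω : ℂ) • φ +
          (((2 * Real.pi) ^ 2 : ℝ) : ℂ) •
            SchwartzMap.smulLeftCLM ℂ (fun x : Plane ↦ ((‖x‖ ^ 2 : ℝ) : ℂ)) φ) := by
      rw [e1, map_add, map_smul, map_smul]
      rfl
    rw [Lp.toTemperedDistribution_apply, Lp.toTemperedDistribution_apply] at e2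
    rw [e2]
    refine integral_congr_ae ?_
    filter_upwards [Lp.coeFn_smul (-c) ((memLp_greenSymbol hω).toLp (greenSymbol ω)),
      (memLp_greenSymbol hω).coeFn_toLp] with x hx hx'
    have h4 : ω + (2 * Real.pi * ‖x‖) ^ 2 ≠ 0 := by positivity
    have h5 : (ω : ℂ) + (2 * Real.pi * ‖x‖) ^ 2 ≠ 0 := by exact_mod_cast h4
    rw [hFf, hx, Pi.smul_apply, hx', add_apply, smul_apply, smul_apply,
      SchwartzMap.smulLeftCLM_apply_apply ht, greenSymbol]
    simp only [smul_eq_mul]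
    push_cast
    rw [mul_pow, mul_pow] at h5
    field_simp
  have hconst : ∀ᵐ x ∂(volume : Measure Plane), (𝓕 p.2 : L2) x = -c := by
    refine ae_eq_of_integral_contDiff_smul_eq
      ((Lp.memLp (𝓕 p.2 : L2)).locallyIntegrable (by norm_num)) (locallyIntegrable_const _) ?_
    intro g hg hgc
    have hg₁ : HasCompactSupport (Complex.ofRealCLM ∘ g) := hgc.comp_left rfl
    have hg₂ : ContDiff ℝ (⊤ : ℕ∞) (Complex.ofRealCLM ∘ g) := by fun_prop
    simpa using key (hg₁.toSchwartzMap hg₂)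
  have hmem : MemLp (fun _ : Plane => -c) 2 volume :=
    (memLp_congr_ae hconst).1 (Lp.memLp (𝓕 p.2 : L2))
  have hc0 : -c = 0 := by
    rcases (memLp_const_iff two_ne_zero ENNReal.ofNat_ne_top).1 hmem with h | h
    · exact h
    · rw [measure_univ_of_isAddLeftInvariant] at h
      exact absurd h (lt_irrefl _)
  have hz : (𝓕 p.2 : L2) = 0 := by
    rw [Lp.eq_zero_iff_ae_eq_zero]
    filter_upwards [hconst] with x hx
    rw [hx, hc0, Pi.zero_apply]
  rw [← norm_eq_zero, ← Lp.norm_fourier_eq, hz, norm_zero]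

/-- `-Δ_α` has the graph above. -/
theorem negLaplacian_graph {α ω : ℝ} (hω : 0 < ω) :
    (negLaplacian α ω hω).graph = graph α ω hω :=
  Submodule.toLinearPMap_graph_eq _ (graph_snd_eq_zero hω)

/-- The operator `ω - Δ_α`, where `-Δ_α` is described by means of the constant `ω₀`. -/
def shifted (α ω₀ : ℝ) (hω₀ : 0 < ω₀) (ω : ℝ) : L2 →ₗ.[ℂ] L2 :=
  ((ω : ℂ) • (LinearMap.id : L2 →ₗ[ℂ] L2)) +ᵥ negLaplacian α ω₀ hω₀

/-- The perturbed Sobolev space `H^s_α(ℝ²) = 𝒟((ω - Δ_α)^{s/2}) = (ω - Δ_α)^{-s/2} L²(ℝ²)`. -/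
def perturbedSobolev (α ω₀ : ℝ) (hω₀ : 0 < ω₀) (ω s : ℝ) : Submodule ℂ L2 :=
  ((shifted α ω₀ hω₀ ω).fracPow (s / 2)).domain

/-- The norm `‖(ω - Δ_α)^{s/2} g‖` of `H^s_α(ℝ²)`. -/
def perturbedNorm (α ω₀ : ℝ) (hω₀ : 0 < ω₀) (ω s : ℝ)
    (g : perturbedSobolev α ω₀ hω₀ ω s) : ℝ :=
  ‖(shifted α ω₀ hω₀ ω).fracPow (s / 2) g‖

/-- The norm `(∫ (1 + |k|²)^s |ĝ(k)|² dk)^{1/2}` of `H^s(ℝ²)`, with `k = 2πξ`. -/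
def sobolevNorm (s : ℝ) (g : L2) : ℝ :=
  Real.sqrt (∫ ξ : Plane, (1 + (2 * Real.pi * ‖ξ‖) ^ 2) ^ s * ‖(𝓕 g : L2) ξ‖ ^ 2)

end PointInteraction

end

open PointInteraction

/-! Write `R` for `(ω - Δ)⁻¹`, `G` for the Green function at `ω`, and `K` for `(ω - Δ_α)⁻¹`. Krein's
formula (`isBoundedInverse_shifted`) gives `K = R + β_α(ω)⁻¹ |G⟩⟨G|`, and `ω > |e_α|` means exactly
that `β_α(ω) > 0`, so `R ≤ K`.

The space `H^s` is the range of `R ^ (s/2)`, and `H^s_α` is the range of `K ^ (s/2)`. By Douglas'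
range argument (`exists_apply_eq_of_norm_apply_le`), two injective self-adjoint operators `S`, `T`
with `‖S x‖` and `‖T x‖` comparable have the same range, with comparable norms of preimages. It
therefore suffices to compare the forms of `R ^ s` and `K ^ s`.

The bound `R ^ s ≤ K ^ s` is the Löwner–Heinz inequality. For the converse up to a constant, `K ^ s
- R ^ s` is a multiple of `∫ t ^ s ((t + R)⁻¹ - (t + K)⁻¹) dt` over `t > 0`. The integrand is at
most its first order term `t ^ s (t + R)⁻¹ (K - R) (t + R)⁻¹`, whose form at `x` is `β⁻¹ t ^ s |⟨G,
(t + R)⁻¹ x⟩|²`. With `m = 1 / (ω + |k|²)`, the inner product is the integral of `m / (t + m)`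
against the Fourier transform of `x`, and a Schur test (`exists_schur_bound`) bounds the integral in
`t` by a multiple of `⟨x, R ^ s x⟩`. The test works because `|k|²` is distributed in the plane like
Lebesgue measure on a half-line; it needs an exponent strictly between `s` and `1`, which is where
`s < 1` enters. -/

/-! ### Operator theory -/

section CStarAlgebra

open Set Real
open scoped NNReal CStarAlgebra

variable {A : Type*} [CStarAlgebra A] [PartialOrder A] [StarOrderedRing A]

/-- The integral representation of `a ^ p`, `0 < p < 1`, with respect to Lebesgue measure. -/
theorem CFC.rpow_eq_smul_setIntegral_rpowIntegrand₀₁ {p : ℝ} (hp : p ∈ Ioo (0 : ℝ) 1)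
    {a : A} (ha : 0 ≤ a) :
    IntegrableOn (fun t => cfc (rpowIntegrand₀₁ p t) a) (Ioi 0) ∧
      a ^ p = (∫ t in Ioi 0, rpowIntegrand₀₁ p t 1)⁻¹ •
        ∫ t in Ioi 0, cfc (rpowIntegrand₀₁ p t) a := by
  nontriviality A
  have hspec : ∀ x ∈ spectrum ℝ a, 0 ≤ x := fun x hx => spectrum_nonneg_of_nonneg ha hx
  let maxr := sSup (spectrum ℝ a)
  have hne : (spectrum ℝ a).Nonempty :=
    ContinuousFunctionalCalculus.spectrum_nonempty a ha.isSelfAdjoint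
  have hbdd : BddAbove (spectrum ℝ a) := (spectrum.isCompact a).bddAbove
  have maxr_nonneg : 0 ≤ maxr := by
    obtain ⟨x, hx⟩ := hne
    exact (hspec x hx).trans (le_csSup hbdd hx)
  let bound (t : ℝ) := ‖rpowIntegrand₀₁ p t maxr‖
  have hf : ContinuousOn (Function.uncurry (rpowIntegrand₀₁ p)) (Ioi (0 : ℝ) ×ˢ spectrum ℝ a) :=
    continuousOn_rpowIntegrand₀₁_uncurry hp _ fun x hx => hspec x hx
  have hbound : ∀ᵐ t ∂volume.restrict (Ioi (0 : ℝ)), ∀ z ∈ spectrum ℝ a,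
      ‖rpowIntegrand₀₁ p t z‖ ≤ bound t := by
    filter_upwards [ae_restrict_mem measurableSet_Ioi] with t ht z hz
    have ht' : 0 ≤ t := le_of_lt ht
    change _ ≤ ‖rpowIntegrand₀₁ p t maxr‖
    rw [Real.norm_of_nonneg (rpowIntegrand₀₁_nonneg hp.1 ht' (hspec z hz)),
      Real.norm_of_nonneg (rpowIntegrand₀₁_nonneg hp.1 ht' maxr_nonneg)]
    exact rpowIntegrand₀₁_monotoneOn hp ht' (hspec z hz) maxr_nonneg (le_csSup hbdd hz)
  have hfin : HasFiniteIntegral bound (volume.restrict (Ioi (0 : ℝ))) := by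
    rw [hasFiniteIntegral_norm_iff]
    exact (integrableOn_rpowIntegrand₀₁_Ioi hp maxr_nonneg).2
  have hint := integrableOn_cfc measurableSet_Ioi _ bound a hf hbound hfin ha.isSelfAdjoint
  refine ⟨hint, ?_⟩
  rw [← cfc_setIntegral measurableSet_Ioi _ bound a hf hbound hfin ha.isSelfAdjoint,
    CFC.rpow_eq_cfc_real ha]
  have h0 : ∫ t in Ioi 0, rpowIntegrand₀₁ p t 1 ≠ 0 := (integral_rpowIntegrand₀₁_one_pos hp).ne'
  have h1 : (spectrum ℝ a).EqOn (fun r => ∫ t in Ioi 0, rpowIntegrand₀₁ p t r)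
      (fun r => (∫ t in Ioi 0, rpowIntegrand₀₁ p t 1) • r ^ p) := fun r hr => by
    simp only [smul_eq_mul]
    rw [mul_comm]
    exact integral_rpowIntegrand₀₁_eq_rpow_mul_const hp (hspec r hr)
  rw [cfc_congr h1, cfc_smul _ (fun x : ℝ => x ^ p) a
    (continuousOn_id.rpow_const fun x _ => Or.inr hp.1.le), smul_smul,
    inv_mul_cancel₀ h0, one_smul]

theorem CFC.continuousOn_add_inv_spectrum {a : A} (ha : 0 ≤ a) {t : ℝ} (ht : 0 < t) :
    ContinuousOn (fun x : ℝ => (t + x)⁻¹) (spectrum ℝ a) :=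
  ContinuousOn.inv₀ (by fun_prop) fun x hx => by
    have := spectrum_nonneg_of_nonneg ha hx
    positivity

theorem CFC.add_mul_cfc_add_inv {a : A} (ha : 0 ≤ a) {t : ℝ} (ht : 0 < t) :
    (algebraMap ℝ A t + a) * cfc (fun x : ℝ => (t + x)⁻¹) a = 1 := by
  have hc := CFC.continuousOn_add_inv_spectrum ha ht
  have h1 : algebraMap ℝ A t + a = cfc (fun x : ℝ => t + x) a := by
    rw [cfc_const_add t (fun x => x) a, cfc_id' ℝ a]
  rw [h1, ← cfc_mul _ _ a (by fun_prop) hc, ← cfc_one ℝ a]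
  refine cfc_congr fun x hx => ?_
  have := spectrum_nonneg_of_nonneg ha hx
  exact mul_inv_cancel₀ (by positivity)

theorem CFC.cfc_add_inv_mul_add {a : A} (ha : 0 ≤ a) {t : ℝ} (ht : 0 < t) :
    cfc (fun x : ℝ => (t + x)⁻¹) a * (algebraMap ℝ A t + a) = 1 := by
  have hc := CFC.continuousOn_add_inv_spectrum ha ht
  have h1 : algebraMap ℝ A t + a = cfc (fun x : ℝ => t + x) a := by
    rw [cfc_const_add t (fun x => x) a, cfc_id' ℝ a]
  rw [h1, ← cfc_mul _ _ a hc (by fun_prop), ← cfc_one ℝ a]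
  refine cfc_congr fun x hx => ?_
  have := spectrum_nonneg_of_nonneg ha hx
  exact inv_mul_cancel₀ (by positivity)

theorem CFC.cfc_add_inv_nonneg {a : A} (ha : 0 ≤ a) {t : ℝ} (ht : 0 < t) :
    0 ≤ cfc (fun x : ℝ => (t + x)⁻¹) a :=
  cfc_nonneg fun x hx => by
    have := spectrum_nonneg_of_nonneg ha hx
    positivity

/-- The second order term in the expansion of the resolvent has a sign. -/
theorem CFC.cfc_add_inv_sub_le {a b : A} (ha : 0 ≤ a) (hb : 0 ≤ b) {t : ℝ} (ht : 0 < t) :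
    cfc (fun x : ℝ => (t + x)⁻¹) a - cfc (fun x : ℝ => (t + x)⁻¹) b ≤
      cfc (fun x : ℝ => (t + x)⁻¹) a * (b - a) * cfc (fun x : ℝ => (t + x)⁻¹) a := by
  set r := cfc (fun x : ℝ => (t + x)⁻¹) a with hr
  set k := cfc (fun x : ℝ => (t + x)⁻¹) b with hk
  have hr1 := CFC.cfc_add_inv_mul_add ha ht
  have hk1 := CFC.add_mul_cfc_add_inv hb ht
  have hr2 := CFC.add_mul_cfc_add_inv ha ht
  have hk2 := CFC.cfc_add_inv_mul_add hb ht
  rw [← hr] at hr1 hr2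
  rw [← hk] at hk1 hk2
  have hd : b - a = (algebraMap ℝ A t + b) - (algebraMap ℝ A t + a) := by abel
  have h1 : r * (b - a) * k = r - k := by
    rw [hd, mul_sub, sub_mul, mul_assoc, hk1, hr1, mul_one, one_mul]
  have h2 : k * (b - a) * r = r - k := by
    rw [hd, mul_sub, sub_mul, mul_assoc k (_ + a) r, hr2, hk2, mul_one, one_mul]
  have hrs : star r = r := (CFC.cfc_add_inv_nonneg ha ht).isSelfAdjoint.star_eq
  have hds : star (b - a) = b - a := (hb.isSelfAdjoint.sub ha.isSelfAdjoint).star_eq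
  -- Using the resolvent identity in both orders, this positive element is exactly the remainder of
  -- the first order expansion of `k` around `r`.
  have h3 : 0 ≤ star ((b - a) * r) * k * ((b - a) * r) :=
    star_left_conjugate_nonneg (CFC.cfc_add_inv_nonneg hb ht) _
  have h4 : star ((b - a) * r) * k * ((b - a) * r) = r * (b - a) * r - (r - k) := by
    rw [star_mul, hrs, hds]
    have : r * (b - a) * k * ((b - a) * r) = r * (b - a) * (k * (b - a) * r) := by
      simp only [mul_assoc]
    rw [this, h2, mul_sub, h1]
  rw [h4] at h3
  exact sub_nonneg.1 h3

theorem CFC.cfc_rpowIntegrand₀₁_eq {p : ℝ} (hp : p ∈ Ioo (0 : ℝ) 1) {a : A} (ha : 0 ≤ a)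
    {t : ℝ} (ht : 0 < t) :
    cfc (rpowIntegrand₀₁ p t) a =
      algebraMap ℝ A (t ^ (p - 1)) - t ^ p • cfc (fun x : ℝ => (t + x)⁻¹) a := by
  have hc := CFC.continuousOn_add_inv_spectrum ha ht
  rw [rpowIntegrand₀₁_eq_sub hp.2.ne ht, cfc_sub (fun _ => t ^ (p - 1))
    (fun x => t ^ p * (t + x)⁻¹) a (by fun_prop) (hc.const_smul (t ^ p)), cfc_const _ a,
    ← cfc_smul _ _ _ hc]
  rfl

/-- The scalar parts `t ^ (p - 1)` of the two integrands cancel, leaving `t ^ p` times a difference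
of resolvents. -/
theorem CFC.cfc_rpowIntegrand₀₁_sub_le {p : ℝ} (hp : p ∈ Ioo (0 : ℝ) 1) {a b : A} (ha : 0 ≤ a)
    (hb : 0 ≤ b) {t : ℝ} (ht : 0 < t) :
    cfc (rpowIntegrand₀₁ p t) b - cfc (rpowIntegrand₀₁ p t) a ≤
      t ^ p • (cfc (fun x : ℝ => (t + x)⁻¹) a * (b - a) * cfc (fun x : ℝ => (t + x)⁻¹) a) := by
  rw [CFC.cfc_rpowIntegrand₀₁_eq hp ha ht, CFC.cfc_rpowIntegrand₀₁_eq hp hb ht,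
    sub_sub_sub_cancel_left, ← smul_sub]
  exact smul_le_smul_of_nonneg_left (CFC.cfc_add_inv_sub_le ha hb ht) (by positivity)

theorem CFC.rpow_half_mul_rpow_half {a : A} (ha : 0 ≤ a) {s : ℝ} (hs : 0 ≤ s) :
    a ^ (s / 2) * a ^ (s / 2) = a ^ s := by
  rw [CFC.rpow_eq_cfc_real ha, CFC.rpow_eq_cfc_real ha,
    ← cfc_mul (fun x : ℝ => x ^ (s / 2)) (fun x : ℝ => x ^ (s / 2)) a
      (continuousOn_id.rpow_const fun x _ => Or.inr (by positivity))
      (continuousOn_id.rpow_const fun x _ => Or.inr (by positivity))]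
  refine cfc_congr fun x hx => ?_
  have := spectrum_nonneg_of_nonneg ha hx
  rw [← Real.rpow_add_of_nonneg this (by positivity) (by positivity), add_halves]

/-- A homomorphism out of an algebra of functions maps the powers of a nonnegative function to the
powers of its image. -/
theorem StarAlgHom.map_rpow_of_separating {B ι : Type*} [CStarAlgebra B] (χ : ι → B →⋆ₐ[ℂ] ℂ)
    (hχ : ∀ x y, (∀ i, χ i x = χ i y) → x = y) (Φ : B →⋆ₐ[ℂ] A) {a b c : B}
    (ha : a = star c * c) {p : ℝ} (hp : 0 ≤ p) {m : ι → ℝ} (hm : ∀ i, χ i a = (m i : ℝ))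
    (hb : ∀ i, χ i b = (m i ^ p : ℝ)) : Φ a ^ p = Φ b := by
  have hf : Continuous fun x : ℝ => x ^ p := Real.continuous_rpow_const hp
  have hsa : IsSelfAdjoint a := ha ▸ IsSelfAdjoint.star_mul_self c
  -- Characters commute with the functional calculus, so the power can be computed pointwise in the
  -- function algebra before `Φ` is applied.
  have e : cfc (fun x : ℝ => x ^ p) a = b := by
    refine hχ _ _ fun i => ?_
    have h1 := (χ i).map_cfc (fun x : ℝ => x ^ p) a hf.continuousOn (map_continuous (χ i)) hsa
      (hsa.map (χ i))
    rw [h1, hm, hb]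
    exact cfc_algebraMap (A := ℂ) (m i) (fun x : ℝ => x ^ p)
  have h2 := Φ.map_cfc (fun x : ℝ => x ^ p) a hf.continuousOn (map_continuous Φ) hsa (hsa.map Φ)
  have h3 : 0 ≤ Φ a := by
    rw [ha, map_mul, map_star]
    exact star_mul_self_nonneg _
  rw [e] at h2
  rw [h2, CFC.rpow_eq_cfc_real h3]

end CStarAlgebra

/-! ### Range inclusion and quadratic forms of powers of positive operators. -/

section Hilbert

set_option linter.unusedSectionVars false

open Set Real InnerProductSpace

variable {H : Type*} [NormedAddCommGroup H] [InnerProductSpace ℂ H] [CompleteSpace H]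

/-- A self-adjoint operator that is dominated by an injective self-adjoint operator factors
through the latter. -/
theorem ContinuousLinearMap.exists_apply_eq_of_norm_apply_le {S T : H →L[ℂ] H}
    (hS : IsSelfAdjoint S) (hT : IsSelfAdjoint T) (hinj : Function.Injective S) {C : ℝ}
    (hC : 0 ≤ C) (h : ∀ x, ‖T x‖ ≤ C * ‖S x‖) (x : H) : ∃ y, S y = T x ∧ ‖y‖ ≤ C * ‖x‖ := by
  have hdense : DenseRange S := by
    have h1 : (LinearMap.range S.toLinearMap)ᗮ = ⊥ := by
      rw [ContinuousLinearMap.orthogonal_range, ← ContinuousLinearMap.star_eq_adjoint, hS.star_eq]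
      exact LinearMap.ker_eq_bot.2 hinj
    have h2 := (Submodule.topologicalClosure_eq_top_iff).2 h1
    have h3 := (Submodule.dense_iff_topologicalClosure_eq_top).2 h2
    exact h3
  -- The domination makes `S z ↦ T z` well defined and bounded on the dense range of `S`. Taking
  -- adjoints in `D S = T` gives `S D* = T`, so `D* x` is the required preimage.
  let D : H →L[ℂ] H := T.toLinearMap.extendOfNorm S.toLinearMap
  have hD : ∀ z, D (S z) = T z := fun z =>
    LinearMap.extendOfNorm_eq (f := T.toLinearMap) (e := S.toLinearMap) hdense ⟨C, h⟩ z
  have hDn : ‖D‖ ≤ C :=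
    LinearMap.opNorm_extendOfNorm_le (f := T.toLinearMap) (e := S.toLinearMap) hdense hC h
  refine ⟨adjoint D x, ?_, ?_⟩
  · refine ext_inner_left ℂ fun z => ?_
    have e1 : ⟪z, S (adjoint D x)⟫_ℂ = ⟪S z, adjoint D x⟫_ℂ := by
      rw [← ContinuousLinearMap.adjoint_inner_left, ← ContinuousLinearMap.star_eq_adjoint,
        hS.star_eq]
    rw [e1, ContinuousLinearMap.adjoint_inner_right, hD, ← ContinuousLinearMap.adjoint_inner_right,
      ← ContinuousLinearMap.star_eq_adjoint, hT.star_eq]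
  · refine (ContinuousLinearMap.le_opNorm _ _).trans ?_
    rw [LinearIsometryEquiv.norm_map]
    gcongr

theorem ContinuousLinearMap.re_inner_le_of_le {A B : H →L[ℂ] H} (h : A ≤ B) (x : H) :
    (⟪x, A x⟫_ℂ).re ≤ (⟪x, B x⟫_ℂ).re := by
  have := ((ContinuousLinearMap.le_def A B).1 h).re_inner_nonneg_right x
  simpa [inner_sub_right] using this

/-- The power `a ^ p` of a positive operator. -/
noncomputable def ContinuousLinearMap.posPow (a : H →L[ℂ] H) (p : ℝ) : H →L[ℂ] H := a ^ p

theorem ContinuousLinearMap.posPow_mono {p : ℝ} (hp : p ∈ Icc (0 : ℝ) 1) {a b : H →L[ℂ] H}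
    (hab : a ≤ b) : a.posPow p ≤ b.posPow p :=
  CFC.rpow_le_rpow hp hab

theorem ContinuousLinearMap.posPow_zero {a : H →L[ℂ] H} (ha : 0 ≤ a) : a.posPow 0 = 1 :=
  CFC.rpow_zero a ha

theorem ContinuousLinearMap.isSelfAdjoint_posPow (a : H →L[ℂ] H) (p : ℝ) :
    IsSelfAdjoint (a.posPow p) :=
  (CFC.rpow_nonneg (a := a) (y := p)).isSelfAdjoint

/-- Translates between the norms used in the range argument and the forms to which operator
inequalities apply. -/
theorem ContinuousLinearMap.norm_posPow_half_sq {a : H →L[ℂ] H} (ha : 0 ≤ a) {s : ℝ} (hs : 0 ≤ s)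
    (x : H) : ‖a.posPow (s / 2) x‖ ^ 2 = (⟪x, a.posPow s x⟫_ℂ).re := by
  have h1 : a.posPow s = a.posPow (s / 2) * a.posPow (s / 2) :=
    (CFC.rpow_half_mul_rpow_half ha hs).symm
  have h2 : ⟪x, a.posPow s x⟫_ℂ = ⟪a.posPow (s / 2) x, a.posPow (s / 2) x⟫_ℂ := by
    rw [h1, ← ContinuousLinearMap.adjoint_inner_right, ← ContinuousLinearMap.star_eq_adjoint,
      (a.isSelfAdjoint_posPow (s / 2)).star_eq]
    rfl
  rw [h2, @norm_sq_eq_re_inner ℂ]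
  rfl

/-- The form of `b ^ p` is controlled by the form of `a ^ p` and the forms of
`(t + a)⁻¹ * (b - a) * (t + a)⁻¹`, `0 < t`. -/
theorem ContinuousLinearMap.re_inner_posPow_le {p : ℝ} (hp : p ∈ Ioo (0 : ℝ) 1)
    {a b : H →L[ℂ] H} (ha : 0 ≤ a) (hb : 0 ≤ b) {r : ℝ → H →L[ℂ] H}
    (hr : ∀ t, 0 < t → r t * ((t : ℂ) • 1 + a) = 1) (x : H) {C : ℝ} (hC : 0 ≤ C)
    (h : ∫⁻ t in Ioi (0 : ℝ), ENNReal.ofReal (t ^ p * (⟪r t x, (b - a) (r t x)⟫_ℂ).re) ≤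
      ENNReal.ofReal C) :
    (⟪x, b.posPow p x⟫_ℂ).re ≤
      (⟪x, a.posPow p x⟫_ℂ).re + (∫ t in Ioi 0, rpowIntegrand₀₁ p t 1)⁻¹ * C := by
  set c := (∫ t in Ioi 0, rpowIntegrand₀₁ p t 1)⁻¹ with hc
  have hc0 : 0 ≤ c := (inv_pos.2 (integral_rpowIntegrand₀₁_one_pos hp)).le
  obtain ⟨hia, hea⟩ := CFC.rpow_eq_smul_setIntegral_rpowIntegrand₀₁ hp ha
  obtain ⟨hib, heb⟩ := CFC.rpow_eq_smul_setIntegral_rpowIntegrand₀₁ hp hb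
  let L : (H →L[ℂ] H) →L[ℝ] ℝ :=
    Complex.reCLM ∘L ((innerSL ℂ x).restrictScalars ℝ) ∘L
      ((ContinuousLinearMap.apply ℂ H x).restrictScalars ℝ)
  have hL : ∀ A, L A = (⟪x, A x⟫_ℂ).re := fun A => rfl
  have key : L (b ^ p) - L (a ^ p) = c * ∫ t in Ioi (0 : ℝ),
      L (cfc (rpowIntegrand₀₁ p t) b - cfc (rpowIntegrand₀₁ p t) a) := by
    have e1 := L.integral_comp_comm (hib.sub hia)
    simp only [Pi.sub_apply] at e1
    rw [e1, integral_sub hib hia, ← map_sub, heb, hea, ← smul_sub, map_smul, smul_eq_mul]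
  have hI : Integrable (fun t => L (cfc (rpowIntegrand₀₁ p t) b - cfc (rpowIntegrand₀₁ p t) a))
      (volume.restrict (Ioi (0 : ℝ))) := L.integrable_comp (hib.sub hia)
  have hle : ∫ t in Ioi (0 : ℝ), L (cfc (rpowIntegrand₀₁ p t) b - cfc (rpowIntegrand₀₁ p t) a)
      ≤ C := by
    -- Only the positive part has to be bounded, and doing so with lower integrals avoids proving
    -- that the majorant is measurable in `t`.
    rw [integral_eq_lintegral_pos_part_sub_lintegral_neg_part hI]
    refine (sub_le_self _ ENNReal.toReal_nonneg).trans ?_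
    refine ENNReal.toReal_le_of_le_ofReal hC (le_trans ?_ h)
    refine setLIntegral_mono' measurableSet_Ioi fun t ht => ENNReal.ofReal_le_ofReal ?_
    have h1 := ContinuousLinearMap.re_inner_le_of_le
      (CFC.cfc_rpowIntegrand₀₁_sub_le hp ha hb (t := t) ht) x
    rw [hL]
    refine h1.trans (le_of_eq ?_)
    have hrt : r t = cfc (fun y : ℝ => (t + y)⁻¹) a := by
      have e2 := CFC.add_mul_cfc_add_inv ha (t := t) ht
      have e3 : algebraMap ℝ (H →L[ℂ] H) t = (t : ℂ) • 1 := by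
        rw [Algebra.algebraMap_eq_smul_one, Complex.coe_smul]
      rw [e3] at e2
      rw [← mul_one (r t), ← e2, ← mul_assoc, hr t ht, one_mul]
    rw [← hrt]
    have hrs : star (r t) = r t := by
      rw [hrt]
      exact (CFC.cfc_add_inv_nonneg ha ht).isSelfAdjoint.star_eq
    have e1 : ⟪r t x, (b - a) (r t x)⟫_ℂ = ⟪x, r t ((b - a) (r t x))⟫_ℂ := by
      rw [← ContinuousLinearMap.adjoint_inner_right, ← ContinuousLinearMap.star_eq_adjoint, hrs]
    rw [e1, smul_apply, inner_smul_right_eq_smul, Complex.smul_re, smul_eq_mul]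
    rfl
  change L (b ^ p) ≤ L (a ^ p) + _
  linarith [mul_le_mul_of_nonneg_left hle hc0]

end Hilbert

/-! ### Bounded Fourier multipliers on `L²` -/

namespace PointInteraction

open scoped BoundedContinuousFunction InnerProductSpace

theorem fourier_injective {u v : L2} (h : (𝓕 u : L2) =ᵐ[volume] (𝓕 v : L2)) : u = v := by
  rw [← FourierTransform.fourierInv_fourier_eq (F := L2) u, Lp.ext h,
    FourierTransform.fourierInv_fourier_eq]

/-- The operator with the bounded continuous Fourier symbol `φ`. -/
noncomputable def fourierMul (φ : Plane →ᵇ ℂ) : L2 →L[ℂ] L2 :=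
  ((Lp.fourierTransformₗᵢ Plane ℂ).symm.toContinuousLinearEquiv : L2 →L[ℂ] L2) ∘L
    ((ContinuousLinearMap.mul ℂ ℂ).holderL volume ⊤ 2 2 (φ.memLp_top.toLp φ)) ∘L
      ((Lp.fourierTransformₗᵢ Plane ℂ).toContinuousLinearEquiv : L2 →L[ℂ] L2)

theorem fourier_fourierMul (φ : Plane →ᵇ ℂ) (u : L2) :
    (𝓕 (fourierMul φ u) : L2) =ᵐ[volume] fun ξ => φ ξ * (𝓕 u : L2) ξ := by
  have h : (𝓕 (fourierMul φ u) : L2) =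
      (ContinuousLinearMap.mul ℂ ℂ).holder 2 (φ.memLp_top.toLp φ) (𝓕 u : L2) :=
    (Lp.fourierTransformₗᵢ Plane ℂ).apply_symm_apply _
  rw [h]
  filter_upwards [(ContinuousLinearMap.mul ℂ ℂ).coeFn_holder (r := 2)
    (φ.memLp_top.toLp φ (μ := volume)) (𝓕 u : L2), φ.memLp_top.coeFn_toLp (μ := volume)]
    with ξ h1 h2
  rw [h1, h2]
  rfl

theorem fourierMul_eq_iff {φ : Plane →ᵇ ℂ} {u v : L2} :
    v = fourierMul φ u ↔ (𝓕 v : L2) =ᵐ[volume] fun ξ => φ ξ * (𝓕 u : L2) ξ :=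
  ⟨fun h => h ▸ fourier_fourierMul φ u, fun h => fourier_injective
    (h.trans (fourier_fourierMul φ u).symm)⟩

theorem fourier_add_ae (u v : L2) :
    (𝓕 (u + v) : L2) =ᵐ[volume] fun ξ => (𝓕 u : L2) ξ + (𝓕 v : L2) ξ := by
  rw [FourierTransform.fourier_add]
  exact Lp.coeFn_add _ _

theorem fourier_smul_ae (c : ℂ) (u : L2) :
    (𝓕 (c • u) : L2) =ᵐ[volume] fun ξ => c * (𝓕 u : L2) ξ := by
  rw [FourierTransform.fourier_smul]
  exact Lp.coeFn_smul _ _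

theorem inner_eq_integral_fourier (u v : L2) :
    ⟪u, v⟫_ℂ = ∫ ξ, (starRingEnd ℂ) ((𝓕 u : L2) ξ) * (𝓕 v : L2) ξ := by
  rw [← Lp.inner_fourier_eq, L2.inner_def]
  refine integral_congr_ae (Filter.Eventually.of_forall fun ξ => ?_)
  exact (RCLike.inner_apply _ _).trans (mul_comm _ _)

theorem norm_sq_eq_integral_fourier (u : L2) : ‖u‖ ^ 2 = ∫ ξ, ‖(𝓕 u : L2) ξ‖ ^ 2 := by
  have h1 : ((‖u‖ ^ 2 : ℝ) : ℂ) = ((∫ ξ, ‖(𝓕 u : L2) ξ‖ ^ 2 : ℝ) : ℂ) := by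
    rw [← integral_complex_ofReal, Complex.ofReal_pow, ← RCLike.ofReal_eq_complex_ofReal,
      ← inner_self_eq_norm_sq_to_K (𝕜 := ℂ) u,
      inner_eq_integral_fourier]
    refine integral_congr_ae (Filter.Eventually.of_forall fun ξ => ?_)
    simp only [RCLike.conj_mul]
    simp
  exact_mod_cast h1

/-- Bounded continuous Fourier symbols act on `L²` by a homomorphism of star algebras. -/
noncomputable def fourierMulHom : (Plane →ᵇ ℂ) →⋆ₐ[ℂ] (L2 →L[ℂ] L2) where
  toFun := fourierMul
  map_one' := by
    ext1 u
    symm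
    rw [fourierMul_eq_iff]
    simp
  map_mul' φ ψ := by
    ext1 u
    symm
    rw [fourierMul_eq_iff]
    filter_upwards [fourier_fourierMul φ (fourierMul ψ u), fourier_fourierMul ψ u] with ξ h1 h2
    rw [mul_apply_eq_comp, h1, h2, BoundedContinuousFunction.mul_apply, mul_assoc]
  map_zero' := by
    ext1 u
    symm
    rw [fourierMul_eq_iff]
    filter_upwards [fourier_smul_ae 0 u] with ξ h1
    rw [zero_smul] at h1
    exact h1
  map_add' φ ψ := by
    ext1 u
    symm
    rw [fourierMul_eq_iff]
    filter_upwards [fourier_add_ae (fourierMul φ u) (fourierMul ψ u), fourier_fourierMul φ u,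
      fourier_fourierMul ψ u] with ξ h1 h2 h3
    rw [add_apply, h1, h2, h3, BoundedContinuousFunction.add_apply, add_mul]
  commutes' c := by
    ext1 u
    symm
    rw [fourierMul_eq_iff]
    filter_upwards [fourier_smul_ae c u] with ξ h1
    exact h1
  map_star' φ := by
    rw [ContinuousLinearMap.star_eq_adjoint, ContinuousLinearMap.eq_adjoint_iff]
    intro u v
    rw [inner_eq_integral_fourier, inner_eq_integral_fourier]
    refine integral_congr_ae ?_
    filter_upwards [fourier_fourierMul (star φ) u, fourier_fourierMul φ v] with ξ h1 h2
    rw [h1, h2, BoundedContinuousFunction.star_apply, map_mul, Complex.star_def,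
      Complex.conj_conj]
    ring

theorem fourierMulHom_apply (φ : Plane →ᵇ ℂ) : fourierMulHom φ = fourierMul φ := rfl

/-- Evaluation at a point, as a homomorphism of star algebras. -/
noncomputable def evalHom (ξ : Plane) : (Plane →ᵇ ℂ) →⋆ₐ[ℂ] ℂ where
  toFun φ := φ ξ
  map_one' := rfl
  map_mul' _ _ := rfl
  map_zero' := rfl
  map_add' _ _ := rfl
  commutes' _ := rfl
  map_star' _ := rfl

/-- Elements `star χ * χ` are preserved by star homomorphisms, so positivity passes to multipliers
without any order on the symbols; `χ` is the pointwise square root. -/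
theorem exists_eq_star_mul_self_of_nonneg {φ : Plane →ᵇ ℂ} {m : Plane → ℝ}
    (hφ : ∀ ξ, φ ξ = m ξ) (hm : ∀ ξ, 0 ≤ m ξ) : ∃ χ : Plane →ᵇ ℂ, φ = star χ * χ := by
  have hmc : Continuous m := by
    have : m = fun ξ => (φ ξ).re := by
      ext ξ
      rw [hφ, Complex.ofReal_re]
    rw [this]
    fun_prop
  refine ⟨BoundedContinuousFunction.ofNormedAddCommGroup (fun ξ => ((Real.sqrt (m ξ) : ℝ) : ℂ))
    (by fun_prop) (Real.sqrt ‖φ‖) fun ξ => ?_, ?_⟩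
  · rw [Complex.norm_real, Real.norm_of_nonneg (Real.sqrt_nonneg _)]
    refine Real.sqrt_le_sqrt ?_
    have := φ.norm_coe_le_norm ξ
    rwa [hφ, Complex.norm_real, Real.norm_of_nonneg (hm ξ)] at this
  · ext ξ
    rw [BoundedContinuousFunction.mul_apply, BoundedContinuousFunction.star_apply]
    simp only [BoundedContinuousFunction.coe_ofNormedAddCommGroup, Complex.star_def,
      Complex.conj_ofReal]
    rw [← Complex.ofReal_mul, Real.mul_self_sqrt (hm ξ), hφ]

theorem fourierMul_nonneg {φ : Plane →ᵇ ℂ} {m : Plane → ℝ}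
    (hφ : ∀ ξ, φ ξ = m ξ) (hm : ∀ ξ, 0 ≤ m ξ) : 0 ≤ fourierMul φ := by
  obtain ⟨χ, hχ⟩ := exists_eq_star_mul_self_of_nonneg hφ hm
  rw [← fourierMulHom_apply, hχ, map_mul, map_star]
  exact star_mul_self_nonneg _

/-- The powers of a Fourier multiplier act on the symbol. -/
theorem posPow_fourierMul {φ ψ : Plane →ᵇ ℂ} {m : Plane → ℝ} {p : ℝ} (hp : 0 ≤ p)
    (hφ : ∀ ξ, φ ξ = m ξ) (hm : ∀ ξ, 0 ≤ m ξ) (hψ : ∀ ξ, ψ ξ = (m ξ ^ p : ℝ)) :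
    (fourierMul φ).posPow p = fourierMul ψ := by
  obtain ⟨χ, hχ⟩ := exists_eq_star_mul_self_of_nonneg hφ hm
  exact StarAlgHom.map_rpow_of_separating evalHom (fun _ _ h => BoundedContinuousFunction.ext h)
    fourierMulHom hχ hp hφ hψ

end PointInteraction

/-! ### Radial integrals in the plane and a Schur test -/

namespace PointInteraction

open Set Real

section Radial

variable {E : Type*} [NormedAddCommGroup E] [NormedSpace ℝ E]

/-- The weight `y` of planar polar coordinates is, up to `8π²`, the Jacobian of `r = 2πy` followed
by `u = r²`; the factors are arranged for these two substitutions. -/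
theorem mul_comp_sq_eqOn (g : ℝ → E) :
    EqOn (fun y : ℝ => y • g ((2 * π * y) ^ 2))
      (fun y : ℝ => (8 * π ^ 2)⁻¹ • ((2 * π) • ((|(2 : ℝ)| * (2 * π * y) ^ ((2 : ℝ) - 1)) •
        g ((2 * π * y) ^ (2 : ℝ)))) ) (Ioi 0) := by
  intro y _
  simp only [smul_smul]
  norm_num
  congr 1
  field_simp
  norm_num

theorem integrable_comp_sq_norm {g : ℝ → E} :
    Integrable (fun ξ : Plane => g ((2 * π * ‖ξ‖) ^ 2)) ↔ IntegrableOn g (Ioi 0) := by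
  rw [integrable_fun_norm_addHaar volume (f := fun y => g ((2 * π * y) ^ 2))]
  simp only [finrank_euclideanSpace, Fintype.card_fin, Nat.add_one_sub_one, pow_one]
  rw [integrableOn_congr_fun (mul_comp_sq_eqOn g) measurableSet_Ioi,
    IntegrableOn, integrable_fun_smul_iff (by positivity), integrable_fun_smul_iff (by positivity),
    ← IntegrableOn,
    integrableOn_Ioi_comp_mul_left_iff (fun y : ℝ => (|(2 : ℝ)| * y ^ ((2 : ℝ) - 1)) •
      g (y ^ (2 : ℝ))) 0 (by positivity : 0 < 2 * π), mul_zero,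
    integrableOn_Ioi_comp_rpow_iff g two_ne_zero]

theorem integral_comp_sq_norm (g : ℝ → E) :
    ∫ ξ : Plane, g ((2 * π * ‖ξ‖) ^ 2) = (4 * π)⁻¹ • ∫ u in Ioi (0 : ℝ), g u := by
  rw [integral_fun_norm_addHaar volume (f := fun y => g ((2 * π * y) ^ 2))]
  simp only [finrank_euclideanSpace, Fintype.card_fin, Nat.add_one_sub_one, pow_one]
  rw [setIntegral_congr_fun measurableSet_Ioi (mul_comp_sq_eqOn g), integral_smul, integral_smul,
    integral_comp_mul_left_Ioi (fun y : ℝ => (|(2 : ℝ)| * y ^ ((2 : ℝ) - 1)) •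
      g (y ^ (2 : ℝ))) 0 (by positivity : 0 < 2 * π), mul_zero,
    integral_comp_rpow_Ioi g two_ne_zero, ← Nat.cast_smul_eq_nsmul ℝ, smul_smul, smul_smul,
    smul_smul, smul_smul]
  congr 1
  rw [Measure.real, EuclideanSpace.volume_ball_fin_two]
  rw [ENNReal.ofReal_one, one_pow, one_mul, ENNReal.toReal_ofReal pi_pos.le]
  field_simp
  norm_num

end Radial

/-- The symbol of `(ω - Δ)⁻¹`, as a real function. -/
noncomputable def realSymbol (ω : ℝ) (ξ : Plane) : ℝ := (ω + (2 * π * ‖ξ‖) ^ 2)⁻¹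

theorem realSymbol_pos {ω : ℝ} (hω : 0 < ω) (ξ : Plane) : 0 < realSymbol ω ξ := by
  unfold realSymbol
  positivity

theorem continuous_realSymbol {ω : ℝ} (hω : 0 < ω) : Continuous (realSymbol ω) := by
  unfold realSymbol
  exact Continuous.inv₀ (by fun_prop) fun ξ => by positivity

theorem realSymbol_le {ω : ℝ} (hω : 0 < ω) (ξ : Plane) : realSymbol ω ξ ≤ ω⁻¹ := by
  unfold realSymbol
  gcongr
  nlinarith [sq_nonneg (2 * π * ‖ξ‖)]

theorem lintegral_mul_sq_le {X : Type*} [MeasurableSpace X] (μ : Measure X) {f g : X → ENNReal}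
    (hf : AEMeasurable f μ) (hg : AEMeasurable g μ) :
    (∫⁻ x, f x * g x ∂μ) ^ 2 ≤ (∫⁻ x, f x ^ 2 ∂μ) * ∫⁻ x, g x ^ 2 ∂μ := by
  have h := ENNReal.lintegral_mul_le_Lp_mul_Lq μ Real.HolderConjugate.two_two hf hg
  simp only [Pi.mul_apply, ENNReal.rpow_two] at h
  calc (∫⁻ x, f x * g x ∂μ) ^ 2
      ≤ ((∫⁻ x, f x ^ 2 ∂μ) ^ (1 / 2 : ℝ) * (∫⁻ x, g x ^ 2 ∂μ) ^ (1 / 2 : ℝ)) ^ 2 := by gcongr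
    _ = _ := by
      rw [mul_pow, ← ENNReal.rpow_two, ← ENNReal.rpow_two, ← ENNReal.rpow_mul, ← ENNReal.rpow_mul]
      norm_num

theorem lintegral_rpowIntegrand₀₁ {q x : ℝ} (hq : q ∈ Ioo (0 : ℝ) 1) (hx : 0 ≤ x) :
    ∫⁻ t in Ioi (0 : ℝ), ENNReal.ofReal (rpowIntegrand₀₁ q t x) =
      ENNReal.ofReal (x ^ q * ∫ t in Ioi 0, rpowIntegrand₀₁ q t 1) := by
  rw [← integral_rpowIntegrand₀₁_eq_rpow_mul_const hq hx,
    ofReal_integral_eq_lintegral_ofReal (integrableOn_rpowIntegrand₀₁_Ioi hq hx)]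
  exact ae_restrict_of_forall_mem measurableSet_Ioi fun t ht =>
    rpowIntegrand₀₁_nonneg hq.1 (le_of_lt ht) hx

/-- In the variable `u = |k|²`, dropping `ω` only enlarges the integrand because `q < 1`. What
remains is `rpowIntegrand₀₁ q u t⁻¹`, with `u` as integration variable and `t⁻¹` as base, whose
integral is a multiple of `t ^ (-q)`. -/
theorem lintegral_rpow_realSymbol_le {ω : ℝ} (hω : 0 < ω) {q : ℝ} (hq : q ∈ Ioo (0 : ℝ) 1) {t : ℝ}
    (ht : 0 < t) :
    ∫⁻ ξ, ENNReal.ofReal (realSymbol ω ξ ^ (2 - q) / (t + realSymbol ω ξ)) ≤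
      ENNReal.ofReal (((4 * π)⁻¹ * ∫ u in Ioi 0, rpowIntegrand₀₁ q u 1) * t ^ (-q)) := by
  have ht' : 0 ≤ t⁻¹ := by positivity
  have hI := integrable_comp_sq_norm.2 (integrableOn_rpowIntegrand₀₁_Ioi hq ht')
  have hnn : ∀ ξ : Plane, 0 ≤ rpowIntegrand₀₁ q ((2 * π * ‖ξ‖) ^ 2) t⁻¹ := fun ξ =>
    rpowIntegrand₀₁_nonneg hq.1 (sq_nonneg _) ht'
  have hval : ∫ ξ : Plane, rpowIntegrand₀₁ q ((2 * π * ‖ξ‖) ^ 2) t⁻¹ =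
      ((4 * π)⁻¹ * ∫ u in Ioi 0, rpowIntegrand₀₁ q u 1) * t ^ (-q) := by
    rw [integral_comp_sq_norm (fun u => rpowIntegrand₀₁ q u t⁻¹),
      integral_rpowIntegrand₀₁_eq_rpow_mul_const hq ht', Real.inv_rpow ht.le, Real.rpow_neg ht.le,
      smul_eq_mul]
    ring
  rw [← hval, ofReal_integral_eq_lintegral_ofReal hI (Filter.Eventually.of_forall hnn)]
  refine lintegral_mono_ae ?_
  have hne : ∀ᵐ ξ : Plane, ξ ≠ 0 := by simp [ae_iff]
  filter_upwards [hne] with ξ hξ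
  refine ENNReal.ofReal_le_ofReal ?_
  have hu : 0 < (2 * π * ‖ξ‖) ^ 2 := by
    have := norm_pos_iff.2 hξ
    positivity
  rw [rpowIntegrand₀₁_eq_pow_div hq hu.le ht', realSymbol]
  set u := (2 * π * ‖ξ‖) ^ 2
  have hωu : 0 < ω + u := by positivity
  have e1 : (ω + u)⁻¹ ^ (2 - q) / (t + (ω + u)⁻¹) = (ω + u) ^ (q - 1) / (t * (ω + u) + 1) := by
    rw [Real.inv_rpow hωu.le, ← Real.rpow_neg hωu.le, show -(2 - q) = (q - 1) - 1 by ring,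
      Real.rpow_sub_one hωu.ne']
    field_simp
  have e2 : u ^ (q - 1) * t⁻¹ / (u + t⁻¹) = u ^ (q - 1) / (t * u + 1) := by
    field_simp
  rw [e1, e2]
  have h3 : (ω + u) ^ (q - 1) ≤ u ^ (q - 1) :=
    Real.rpow_le_rpow_of_nonpos hu (by linarith) (by linarith [hq.2])
  gcongr
  linarith

theorem lintegral_rpow_neg_div_add {a : ℝ} (ha : a ∈ Ioo (0 : ℝ) 1) {x : ℝ} (hx : 0 < x) :
    ∫⁻ t in Ioi (0 : ℝ), ENNReal.ofReal (t ^ (-a) / (t + x)) =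
      ENNReal.ofReal (x ^ (-a) * ∫ t in Ioi 0, rpowIntegrand₀₁ (1 - a) t 1) := by
  have ha' : 1 - a ∈ Ioo (0 : ℝ) 1 := ⟨by linarith [ha.2], by linarith [ha.1]⟩
  have h1 : ∀ t ∈ Ioi (0 : ℝ), ENNReal.ofReal (t ^ (-a) / (t + x)) =
      ENNReal.ofReal x⁻¹ * ENNReal.ofReal (rpowIntegrand₀₁ (1 - a) t x) := fun t ht => by
    have ht0 : 0 < t := ht
    rw [← ENNReal.ofReal_mul (by positivity), rpowIntegrand₀₁_eq_pow_div ha' ht0.le hx.le,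
      show 1 - a - 1 = -a by ring]
    congr 1
    field_simp
  rw [setLIntegral_congr_fun measurableSet_Ioi h1,
    lintegral_const_mul' _ _ ENNReal.ofReal_ne_top, lintegral_rpowIntegrand₀₁ ha' hx.le,
    ← ENNReal.ofReal_mul (by positivity), ← mul_assoc, show (1 - a) = -a + 1 by ring,
    Real.rpow_add_one hx.ne']
  congr 2
  field_simp

/-- A Schur test for the kernel `m / (t + m)`, where `m` is the symbol of `(ω - Δ)⁻¹`. -/
theorem exists_schur_bound {ω : ℝ} (hω : 0 < ω) {p : ℝ} (hp : p ∈ Ioo (0 : ℝ) 1) :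
    ∃ C : ℝ, 0 ≤ C ∧ ∀ H : Plane → ENNReal, AEMeasurable H volume →
      ∫⁻ t in Ioi (0 : ℝ), ENNReal.ofReal (t ^ p) *
        (∫⁻ ξ, ENNReal.ofReal (realSymbol ω ξ / (t + realSymbol ω ξ)) * H ξ) ^ 2 ≤
      ENNReal.ofReal C * ∫⁻ ξ, ENNReal.ofReal (realSymbol ω ξ ^ p) * H ξ ^ 2 := by
  obtain ⟨hp0, hp1⟩ := hp
  -- The exponent `q` is the midpoint of `(p, 1)` and `a = q - p`; both must lie in `(0, 1)` for the
  -- two integrals of the test to converge.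
  set a := (1 - p) / 2 with ha
  set q := (1 + p) / 2 with hq
  have ha' : a ∈ Ioo (0 : ℝ) 1 := ⟨by linarith, by linarith⟩
  have hq' : q ∈ Ioo (0 : ℝ) 1 := ⟨by linarith, by linarith⟩
  have hmm : Measurable (realSymbol ω) := (continuous_realSymbol hω).measurable
  set C₁ := (4 * π)⁻¹ * ∫ u in Ioi 0, rpowIntegrand₀₁ q u 1 with hC₁
  set C₂ := ∫ t in Ioi 0, rpowIntegrand₀₁ (1 - a) t 1 with hC₂
  have hC₁0 : 0 ≤ C₁ := mul_nonneg (by positivity) (integral_rpowIntegrand₀₁_one_pos hq').le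
  have hC₂0 : 0 ≤ C₂ := (integral_rpowIntegrand₀₁_one_pos
    ⟨by linarith [ha'.2], by linarith [ha'.1]⟩).le
  clear_value C₁ C₂
  refine ⟨C₁ * C₂, mul_nonneg hC₁0 hC₂0, fun H hH => ?_⟩
  have hcs : ∀ t ∈ Ioi (0 : ℝ), ENNReal.ofReal (t ^ p) *
      (∫⁻ ξ, ENNReal.ofReal (realSymbol ω ξ / (t + realSymbol ω ξ)) * H ξ) ^ 2 ≤
      ENNReal.ofReal C₁ * ∫⁻ ξ, ENNReal.ofReal (t ^ (-a) / (t + realSymbol ω ξ)) *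
        (ENNReal.ofReal (realSymbol ω ξ ^ q) * H ξ ^ 2) := by
    intro t ht
    have ht0 : 0 < t := ht
    -- Cauchy–Schwarz splitting `m² = m ^ q * m ^ (2 - q)` under the square root. The second factor
    -- integrates to at most `C₁ t ^ (-q)`, which turns `t ^ p` into `t ^ (-a)`.
    have e1 : ∀ ξ, ENNReal.ofReal (realSymbol ω ξ / (t + realSymbol ω ξ)) * H ξ =
        (ENNReal.ofReal (√(realSymbol ω ξ ^ q / (t + realSymbol ω ξ))) * H ξ) *
          ENNReal.ofReal (√(realSymbol ω ξ ^ (2 - q) / (t + realSymbol ω ξ))) := fun ξ => by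
      have hm := realSymbol_pos hω ξ
      rw [mul_right_comm, ← ENNReal.ofReal_mul (by positivity), ← Real.sqrt_mul (by positivity)]
      congr 2
      rw [div_mul_div_comm, ← Real.rpow_add hm, show q + (2 - q) = 2 by ring, Real.rpow_two,
        ← sq, ← div_pow, Real.sqrt_sq (by positivity)]
    have e2 : ∀ ξ, (ENNReal.ofReal (√(realSymbol ω ξ ^ q / (t + realSymbol ω ξ))) * H ξ) ^ 2 =
        ENNReal.ofReal (realSymbol ω ξ ^ q / (t + realSymbol ω ξ)) * H ξ ^ 2 := fun ξ => by
      have hm := realSymbol_pos hω ξ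
      rw [mul_pow, ← ENNReal.ofReal_pow (by positivity), Real.sq_sqrt (by positivity)]
    have e3 : ∀ ξ, ENNReal.ofReal (√(realSymbol ω ξ ^ (2 - q) / (t + realSymbol ω ξ))) ^ 2 =
        ENNReal.ofReal (realSymbol ω ξ ^ (2 - q) / (t + realSymbol ω ξ)) := fun ξ => by
      have hm := realSymbol_pos hω ξ
      rw [← ENNReal.ofReal_pow (by positivity), Real.sq_sqrt (by positivity)]
    have hm1 : AEMeasurable (fun ξ =>
        ENNReal.ofReal (√(realSymbol ω ξ ^ q / (t + realSymbol ω ξ))) * H ξ) volume :=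
      AEMeasurable.mul (Measurable.aemeasurable (by fun_prop)) hH
    have hm2 : AEMeasurable (fun ξ =>
        ENNReal.ofReal (√(realSymbol ω ξ ^ (2 - q) / (t + realSymbol ω ξ)))) volume :=
      Measurable.aemeasurable (by fun_prop)
    have h1 := lintegral_mul_sq_le volume hm1 hm2
    simp only [e2, e3] at h1
    simp only [e1]
    calc _ ≤ ENNReal.ofReal (t ^ p) * ((∫⁻ ξ, ENNReal.ofReal (realSymbol ω ξ ^ q /
              (t + realSymbol ω ξ)) * H ξ ^ 2) * ENNReal.ofReal (C₁ * t ^ (-q))) := by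
          gcongr
          exact h1.trans (by gcongr; exact hC₁ ▸ lintegral_rpow_realSymbol_le hω hq' ht0)
      _ = ENNReal.ofReal C₁ * (ENNReal.ofReal (t ^ (-a)) * ∫⁻ ξ, ENNReal.ofReal
            (realSymbol ω ξ ^ q / (t + realSymbol ω ξ)) * H ξ ^ 2) := by
          rw [ENNReal.ofReal_mul hC₁0, show -a = p + -q by rw [ha, hq]; ring,
            Real.rpow_add ht0, ENNReal.ofReal_mul (p := t ^ p) (by positivity)]
          ring
      _ = _ := by
          rw [← lintegral_const_mul' _ _ ENNReal.ofReal_ne_top]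
          congr 1
          refine lintegral_congr fun ξ => ?_
          have hm := realSymbol_pos hω ξ
          rw [← mul_assoc, ← mul_assoc, ← ENNReal.ofReal_mul (by positivity),
            ← ENNReal.ofReal_mul (by positivity)]
          congr 2
          ring
  -- Tonelli: integrating first in `t` produces `C₂ m ^ (-a)`, and `q - a = p`.
  refine (setLIntegral_mono' measurableSet_Ioi hcs).trans (le_of_eq ?_)
  rw [lintegral_const_mul' _ _ ENNReal.ofReal_ne_top, ENNReal.ofReal_mul hC₁0, mul_assoc,
    lintegral_lintegral_swap]
  · congr 1
    rw [← lintegral_const_mul' _ _ ENNReal.ofReal_ne_top]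
    refine lintegral_congr fun ξ => ?_
    have hm := realSymbol_pos hω ξ
    rw [lintegral_mul_const _ (by fun_prop), lintegral_rpow_neg_div_add ha' hm, ← hC₂, ← mul_assoc,
      ← mul_assoc, ← ENNReal.ofReal_mul (by positivity), ← ENNReal.ofReal_mul (by positivity),
      show p = -a + q by rw [ha, hq]; ring, Real.rpow_add hm]
    congr 2
    ring
  · refine AEMeasurable.mul (Measurable.aemeasurable ?_) (AEMeasurable.mul ?_ ?_)
    · fun_prop
    · exact Measurable.aemeasurable (by fun_prop)
    · exact (hH.comp_quasiMeasurePreserving Measure.quasiMeasurePreserving_snd).pow_const 2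

end PointInteraction

/-! ### Sobolev functions on the Fourier side -/

namespace PointInteraction

open scoped BoundedContinuousFunction InnerProductSpace

theorem ae_eq_of_integral_schwartz_eq {u v : Plane → ℂ} (hu : LocallyIntegrable u)
    (hv : LocallyIntegrable v) (h : ∀ φ : 𝓢(Plane, ℂ), ∫ x, φ x • u x = ∫ x, φ x • v x) :
    u =ᵐ[volume] v := by
  refine ae_eq_of_integral_contDiff_smul_eq hu hv fun g hg hgc => ?_
  have hg₁ : HasCompactSupport (Complex.ofRealCLM ∘ g) := hgc.comp_left rfl
  have hg₂ : ContDiff ℝ (⊤ : ℕ∞) (Complex.ofRealCLM ∘ g) := by fun_prop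
  simpa using h (hg₁.toSchwartzMap hg₂)

theorem locallyIntegrable_L2 (u : L2) : LocallyIntegrable u :=
  (Lp.memLp u).locallyIntegrable (by norm_num)

theorem smulLeftCLM_eq_iff {g : Plane → ℂ} (hg : g.HasTemperateGrowth) (u v : L2) :
    smulLeftCLM ℂ g (u : 𝓢'(Plane, ℂ)) = (v : 𝓢'(Plane, ℂ)) ↔
      v =ᵐ[volume] fun ξ => g ξ * u ξ := by
  have key : ∀ φ : 𝓢(Plane, ℂ), smulLeftCLM ℂ g (u : 𝓢'(Plane, ℂ)) φ =
      ∫ ξ, φ ξ • (g ξ * u ξ) := fun φ => by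
    rw [smulLeftCLM_apply_apply, Lp.toTemperedDistribution_apply]
    refine integral_congr_ae (Filter.Eventually.of_forall fun ξ => ?_)
    simp only [SchwartzMap.smulLeftCLM_apply_apply hg, smul_eq_mul]
    ring
  constructor
  · intro h
    refine ae_eq_of_integral_schwartz_eq (locallyIntegrable_L2 v)
      ((locallyIntegrable_L2 u).continuous_mul hg.1.continuous) fun φ => ?_
    rw [← key, h, Lp.toTemperedDistribution_apply]
  · intro h
    ext φ
    rw [key, Lp.toTemperedDistribution_apply]
    refine integral_congr_ae ?_
    filter_upwards [h] with ξ hξ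
    rw [hξ]

theorem memSobolev_iff_memLp (s : ℝ) (f : L2) : MemSobolev s 2 (f : 𝓢'(Plane, ℂ)) ↔
    MemLp (fun ξ => (((1 + ‖ξ‖ ^ 2) ^ (s / 2) : ℝ) : ℂ) * (𝓕 f : L2) ξ) 2 := by
  have hg : (fun ξ : Plane => (((1 + ‖ξ‖ ^ 2) ^ (s / 2) : ℝ) : ℂ)).HasTemperateGrowth := by
    fun_prop
  rw [memSobolev_iff_exists_smulLeftCLM_fourier, Lp.fourier_toTemperedDistribution_eq]
  simp only [smulLeftCLM_eq_iff hg]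
  constructor
  · rintro ⟨v, hv⟩
    exact (memLp_congr_ae hv).1 (Lp.memLp v)
  · intro h
    exact ⟨h.toLp _, h.coeFn_toLp⟩

/-- Turns the distributional equation in the definition of the graph into a pointwise one, so that
all resolvent computations become algebra with symbols. -/
theorem toTemperedDistribution_eq_sub_laplacian_iff (ω : ℝ) (f y : L2) :
    (y : 𝓢'(Plane, ℂ)) = (ω : ℂ) • (f : 𝓢'(Plane, ℂ)) - Δ (f : 𝓢'(Plane, ℂ)) ↔
      (𝓕 y : L2) =ᵐ[volume]
        fun ξ => ((ω + (2 * Real.pi * ‖ξ‖) ^ 2 : ℝ) : ℂ) * (𝓕 f : L2) ξ := by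
  have hg : (fun x : Plane ↦ ((‖x‖ ^ 2 : ℝ) : ℂ)).HasTemperateGrowth := by fun_prop
  have hg' : (fun x : Plane ↦ ((ω + (2 * Real.pi * ‖x‖) ^ 2 : ℝ) : ℂ)).HasTemperateGrowth := by
    simp only [mul_pow]
    fun_prop
  have e1 : 𝓕 ((ω : ℂ) • (f : 𝓢'(Plane, ℂ)) - Δ (f : 𝓢'(Plane, ℂ))) =
      smulLeftCLM ℂ (fun x : Plane ↦ ((ω + (2 * Real.pi * ‖x‖) ^ 2 : ℝ) : ℂ))
        (𝓕 (f : 𝓢'(Plane, ℂ))) := by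
    rw [laplacian_eq_fourierMultiplierCLM, fourierMultiplierCLM_apply, sub_eq_add_neg,
      ← neg_smul, FourierTransform.fourier_add, FourierTransform.fourier_smul,
      ← Complex.coe_smul, FourierTransform.fourier_smul, FourierTransform.fourier_fourierInv_eq,
      neg_neg]
    ext φ
    have e2 : SchwartzMap.smulLeftCLM ℂ
        (fun x : Plane ↦ ((ω + (2 * Real.pi * ‖x‖) ^ 2 : ℝ) : ℂ)) φ =
        (ω : ℂ) • φ + (((2 * Real.pi) ^ 2 : ℝ) : ℂ) •
            SchwartzMap.smulLeftCLM ℂ (fun x : Plane ↦ ((‖x‖ ^ 2 : ℝ) : ℂ)) φ := by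
      ext x
      rw [SchwartzMap.smulLeftCLM_apply_apply hg', add_apply, smul_apply, smul_apply,
        SchwartzMap.smulLeftCLM_apply_apply hg]
      simp only [smul_eq_mul]
      push_cast
      ring
    rw [smulLeftCLM_apply_apply, e2, map_add, map_smul, map_smul]
    rfl
  rw [← smulLeftCLM_eq_iff hg', ← Lp.fourier_toTemperedDistribution_eq,
    ← Lp.fourier_toTemperedDistribution_eq, ← e1]
  constructor
  · intro h
    rw [← h]
  · intro h
    have := congrArg (fun T : 𝓢'(Plane, ℂ) => 𝓕⁻ T) h
    simpa only [FourierTransform.fourierInv_fourier_eq] using this.symm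

theorem continuous_neg_inner :
    Continuous fun p : Plane × Plane => ((-innerₗ Plane : Plane →ₗ[ℝ] Plane →ₗ[ℝ] ℝ) p.1) p.2 := by
  change Continuous fun p : Plane × Plane => -inner ℝ p.1 p.2
  fun_prop

/-- The inverse Fourier transforms of `L¹` and of `L²` agree. -/
theorem fourierInv_ae_eq {g : L2} (hg : Integrable g) :
    (𝓕⁻ g : L2) =ᵐ[volume] (𝓕⁻ (g : Plane → ℂ) : Plane → ℂ) := by
  have hcont : Continuous (𝓕⁻ (g : Plane → ℂ) : Plane → ℂ) :=
    VectorFourier.fourierIntegral_continuous Real.continuous_fourierChar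
      continuous_neg_inner hg
  refine ae_eq_of_integral_schwartz_eq (locallyIntegrable_L2 _) hcont.locallyIntegrable
    fun φ => ?_
  have e1 : ∫ x, φ x • (𝓕⁻ g : L2) x = ∫ x, (𝓕⁻ φ) x • g x := by
    rw [← Lp.toTemperedDistribution_apply, ← Lp.fourierInv_toTemperedDistribution_eq,
      TemperedDistribution.fourierInv_apply, Lp.toTemperedDistribution_apply]
  rw [e1, SchwartzMap.fourierInv_coe]
  have := VectorFourier.integral_fourierIntegral_smul_eq_flip (μ := volume) (ν := volume)
    (L := -innerₗ Plane) (f := φ) (g := (g : Plane → ℂ)) Real.continuous_fourierChar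
    continuous_neg_inner φ.integrable hg
  have hflip : (-innerₗ Plane).flip = -innerₗ Plane := by
    ext x y
    simp [real_inner_comm]
  rw [hflip] at this
  exact this

/-- An `L²` function with integrable Fourier transform has a continuous representative, and its
value at `0` is the integral of the Fourier transform. -/
theorem exists_continuous_rep {f : L2} (hf : Integrable (𝓕 f : L2)) :
    ∃ F : Plane → ℂ, Continuous F ∧ f =ᵐ[volume] F ∧ F 0 = ∫ ξ, (𝓕 f : L2) ξ := by
  refine ⟨(𝓕⁻ ((𝓕 f : L2) : Plane → ℂ) : Plane → ℂ), ?_, ?_, ?_⟩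
  · exact VectorFourier.fourierIntegral_continuous Real.continuous_fourierChar continuous_neg_inner hf
  · have := fourierInv_ae_eq hf
    rwa [FourierTransform.fourierInv_fourier_eq] at this
  · rw [Real.fourierInv_eq]
    simp

/-- Continuous functions that agree almost everywhere agree at `0`, so the representative chosen in
`graph` does not matter. -/
theorem continuous_rep_zero {f : L2} (hf : Integrable (𝓕 f : L2)) {F : Plane → ℂ}
    (hF : Continuous F) (hfF : f =ᵐ[volume] F) : F 0 = ∫ ξ, (𝓕 f : L2) ξ := by
  obtain ⟨F', hF', hfF', h0⟩ := exists_continuous_rep hf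
  rw [← h0, (Continuous.ae_eq_iff_eq volume hF hF').1 (hfF.symm.trans hfF')]

/-- The symbol of `(ω - Δ) ^ (-σ)`, `0 ≤ σ`. -/
noncomputable def powSymbol {ω : ℝ} (hω : 0 < ω) {σ : ℝ} (hσ : 0 ≤ σ) : Plane →ᵇ ℂ :=
  BoundedContinuousFunction.ofNormedAddCommGroup (fun ξ => ((realSymbol ω ξ ^ σ : ℝ) : ℂ))
    (Complex.continuous_ofReal.comp ((continuous_realSymbol hω).rpow_const fun _ => Or.inr hσ))
    (ω⁻¹ ^ σ) fun ξ => by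
      have h := realSymbol_pos hω ξ
      rw [Complex.norm_real, Real.norm_of_nonneg (by positivity)]
      exact Real.rpow_le_rpow h.le (realSymbol_le hω ξ) hσ

theorem powSymbol_apply {ω : ℝ} (hω : 0 < ω) {σ : ℝ} (hσ : 0 ≤ σ) (ξ : Plane) :
    powSymbol hω hσ ξ = ((realSymbol ω ξ ^ σ : ℝ) : ℂ) := rfl

theorem add_mul_le_max_mul {a b c d x : ℝ} (hc : 0 < c) (hd : 0 < d) (hx : 0 ≤ x) :
    a + b * x ≤ max (a / c) (b / d) * (c + d * x) := by
  have h1 : a ≤ max (a / c) (b / d) * c := by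
    rw [← div_le_iff₀ hc]
    exact le_max_left _ _
  have h2 : b ≤ max (a / c) (b / d) * d := by
    rw [← div_le_iff₀ hd]
    exact le_max_right _ _
  nlinarith [mul_le_mul_of_nonneg_right h2 hx]

/-- The weights `a + b |ξ|²` are comparable to the inverse of the symbol of `(ω - Δ)⁻¹`. -/
theorem exists_rpow_le_realSymbol_rpow {ω : ℝ} (hω : 0 < ω) {a b : ℝ} (ha : 0 < a) (hb : 0 < b)
    {σ : ℝ} (hσ : 0 ≤ σ) : ∃ C, 0 < C ∧ ∀ ξ : Plane,
      (a + b * ‖ξ‖ ^ 2) ^ σ * realSymbol ω ξ ^ σ ≤ C ∧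
      1 ≤ C * ((a + b * ‖ξ‖ ^ 2) ^ σ * realSymbol ω ξ ^ σ) := by
  set d := (2 * Real.pi) ^ 2 with hd
  have hd0 : 0 < d := by positivity
  set A := max (a / ω) (b / d)
  set B := max (ω / a) (d / b)
  have hA : 0 < A := lt_max_of_lt_left (by positivity)
  have hB : 0 < B := lt_max_of_lt_left (by positivity)
  have hsym : ∀ ξ : Plane, realSymbol ω ξ = (ω + d * ‖ξ‖ ^ 2)⁻¹ := fun ξ => by
    rw [realSymbol, mul_pow]
  refine ⟨A ^ σ + B ^ σ, by positivity, fun ξ => ?_⟩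
  have hx : 0 ≤ ‖ξ‖ ^ 2 := by positivity
  set x := ‖ξ‖ ^ 2
  have h1 : (a + b * x) * (ω + d * x)⁻¹ ≤ A := by
    rw [← div_eq_mul_inv, div_le_iff₀ (by positivity)]
    exact add_mul_le_max_mul hω hd0 hx
  have h2 : 1 ≤ B * ((a + b * x) * (ω + d * x)⁻¹) := by
    rw [← mul_assoc, ← div_eq_mul_inv, le_div_iff₀ (by positivity), one_mul]
    exact add_mul_le_max_mul ha hb hx
  rw [hsym, ← Real.mul_rpow (by positivity) (by positivity)]
  have h3 : 0 ≤ (a + b * x) * (ω + d * x)⁻¹ := by positivity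
  constructor
  · refine (Real.rpow_le_rpow h3 h1 hσ).trans ?_
    linarith [Real.rpow_nonneg hB.le σ]
  · have h4 := Real.one_le_rpow h2 hσ
    rw [Real.mul_rpow hB.le h3] at h4
    have h5 : 0 ≤ A ^ σ := by positivity
    have h6 : 0 ≤ ((a + b * x) * (ω + d * x)⁻¹) ^ σ := by positivity
    nlinarith

/-- Exhibits `H^s` as the range of `(ω - Δ) ^ (-s/2)`, the form in which it is compared with
`H^s_α`. -/
theorem memSobolev_iff_exists_fourierMul {ω : ℝ} (hω : 0 < ω) {s : ℝ} (hs : 0 ≤ s) (f : L2) :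
    MemSobolev s 2 (f : 𝓢'(Plane, ℂ)) ↔
      ∃ h : L2, fourierMul (powSymbol hω (div_nonneg hs zero_le_two)) h = f := by
  have hs2 : 0 ≤ s / 2 := div_nonneg hs zero_le_two
  -- `MemSobolev` uses the weight `1 + ‖ξ‖²`, whereas `sobolevNorm` uses `1 + (2π‖ξ‖)²`; hence the
  -- general weights `a + b ‖ξ‖²`.
  obtain ⟨C, hC, hCb⟩ := exists_rpow_le_realSymbol_rpow hω one_pos one_pos hs2
  simp only [one_mul] at hCb
  rw [memSobolev_iff_memLp]
  constructor
  · intro hf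
    have hmeas : AEStronglyMeasurable
        (fun ξ => ((realSymbol ω ξ ^ (-(s / 2)) : ℝ) : ℂ) * (𝓕 f : L2) ξ) volume := by
      refine AEStronglyMeasurable.mul ?_ (Lp.aestronglyMeasurable _)
      have := (continuous_realSymbol hω).measurable
      exact Measurable.aestronglyMeasurable (by fun_prop)
    have hmem : MemLp (fun ξ => ((realSymbol ω ξ ^ (-(s / 2)) : ℝ) : ℂ) * (𝓕 f : L2) ξ) 2 := by
      refine hf.of_le_mul hmeas (c := C) (Filter.Eventually.of_forall fun ξ => ?_)
      have hm := realSymbol_pos hω ξ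
      have h1 := (hCb ξ).2
      rw [norm_mul, norm_mul, Complex.norm_real, Complex.norm_real,
        Real.norm_of_nonneg (by positivity), Real.norm_of_nonneg (by positivity), ← mul_assoc]
      gcongr
      rw [Real.rpow_neg hm.le, ← one_div, div_le_iff₀ (by positivity), mul_assoc]
      exact h1
    refine ⟨𝓕⁻ (hmem.toLp _), Eq.symm ?_⟩
    rw [fourierMul_eq_iff, FourierTransform.fourier_fourierInv_eq]
    filter_upwards [hmem.coeFn_toLp] with ξ hξ
    have hm := realSymbol_pos hω ξ
    rw [hξ, powSymbol_apply, ← mul_assoc, ← Complex.ofReal_mul, ← Real.rpow_add hm,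
      add_neg_cancel, Real.rpow_zero, Complex.ofReal_one, one_mul]
  · rintro ⟨h, hh⟩
    have hae := fourierMul_eq_iff.1 hh.symm
    refine (Lp.memLp (𝓕 h : L2)).of_le_mul (c := C) ?_ ?_
    · refine AEStronglyMeasurable.mul ?_ (Lp.aestronglyMeasurable _)
      exact Measurable.aestronglyMeasurable (by fun_prop)
    · filter_upwards [hae] with ξ hξ
      have hm := realSymbol_pos hω ξ
      rw [hξ, powSymbol_apply, norm_mul, norm_mul, Complex.norm_real, Complex.norm_real,
        Real.norm_of_nonneg (by positivity), Real.norm_of_nonneg (by positivity), ← mul_assoc]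
      gcongr
      exact (hCb ξ).1

theorem exists_sobolevNorm_comparable {ω : ℝ} (hω : 0 < ω) {s : ℝ} (hs : 0 ≤ s) :
    ∃ C, 0 < C ∧ ∀ h : L2,
      sobolevNorm s (fourierMul (powSymbol hω (div_nonneg hs zero_le_two)) h) ≤ C * ‖h‖ ∧
      ‖h‖ ≤ C * sobolevNorm s (fourierMul (powSymbol hω (div_nonneg hs zero_le_two)) h) := by
  have hs2 : 0 ≤ s / 2 := div_nonneg hs zero_le_two
  obtain ⟨C, hC, hCb⟩ := exists_rpow_le_realSymbol_rpow hω one_pos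
    (by positivity : 0 < (2 * Real.pi) ^ 2) hs
  refine ⟨Real.sqrt C, Real.sqrt_pos.2 hC, fun h => ?_⟩
  set f := fourierMul (powSymbol hω (div_nonneg hs zero_le_two)) h with hf
  let w : Plane → ℝ := fun ξ => (1 + (2 * Real.pi) ^ 2 * ‖ξ‖ ^ 2) ^ s * realSymbol ω ξ ^ s
  have hw0 : ∀ ξ, 0 ≤ w ξ := fun ξ => by
    have hm := realSymbol_pos hω ξ
    positivity
  have hae : (fun ξ : Plane => (1 + (2 * Real.pi * ‖ξ‖) ^ 2) ^ s * ‖(𝓕 f : L2) ξ‖ ^ 2) =ᵐ[volume]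
      fun ξ => w ξ * ‖(𝓕 h : L2) ξ‖ ^ 2 := by
    filter_upwards [fourier_fourierMul (powSymbol hω hs2) h] with ξ hξ
    have hm := realSymbol_pos hω ξ
    rw [hf, hξ, powSymbol_apply, norm_mul, Complex.norm_real,
      Real.norm_of_nonneg (by positivity), mul_pow (_ ^ _), ← Real.rpow_mul_natCast hm.le, mul_pow,
      ← mul_assoc]
    congr 3
    push_cast
    ring
  have hint : Integrable (fun ξ => ‖(𝓕 h : L2) ξ‖ ^ 2) := by
    have := (memLp_two_iff_integrable_sq_norm (Lp.aestronglyMeasurable (𝓕 h : L2))).1 (Lp.memLp _)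
    exact this
  have hwm : Measurable w := by
    have := (continuous_realSymbol hω).measurable
    fun_prop
  have hwint : Integrable (fun ξ => w ξ * ‖(𝓕 h : L2) ξ‖ ^ 2) :=
    hint.bdd_mul (c := C) hwm.aestronglyMeasurable (Filter.Eventually.of_forall fun ξ => by
      rw [Real.norm_of_nonneg (hw0 ξ)]
      exact (hCb ξ).1)
  have hnorm : sobolevNorm s f = Real.sqrt (∫ ξ, w ξ * ‖(𝓕 h : L2) ξ‖ ^ 2) := by
    rw [sobolevNorm, integral_congr_ae hae]
  have hh : ‖h‖ = Real.sqrt (∫ ξ, ‖(𝓕 h : L2) ξ‖ ^ 2) := by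
    rw [← norm_sq_eq_integral_fourier, Real.sqrt_sq (norm_nonneg _)]
  rw [hnorm, hh, ← Real.sqrt_mul hC.le, ← Real.sqrt_mul hC.le, ← integral_const_mul,
    ← integral_const_mul]
  constructor
  · refine Real.sqrt_le_sqrt (integral_mono hwint (hint.const_mul C) fun ξ => ?_)
    exact mul_le_mul_of_nonneg_right (hCb ξ).1 (by positivity)
  · refine Real.sqrt_le_sqrt (integral_mono hint (hwint.const_mul C) fun ξ => ?_)
    change _ ≤ C * (w ξ * _)
    rw [← mul_assoc]
    exact le_mul_of_one_le_left (by positivity) (hCb ξ).2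

end PointInteraction

/-! ### The resolvent of the point interaction -/

namespace PointInteraction

open scoped BoundedContinuousFunction InnerProductSpace

theorem beta_sub_beta {ω ω₀ : ℝ} (hω : 0 < ω) (hω₀ : 0 < ω₀) (α : ℝ) :
    beta α ω₀ - beta α ω = (4 * Real.pi)⁻¹ * (Real.log ω₀ - Real.log ω) := by
  unfold beta
  rw [Real.log_div (Real.sqrt_pos.2 hω).ne' two_ne_zero,
    Real.log_div (Real.sqrt_pos.2 hω₀).ne' two_ne_zero, Real.log_sqrt hω.le, Real.log_sqrt hω₀.le]
  field_simp
  ring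

/-- One has `β_α(ω) = (4π)⁻¹ log (ω / |e_α|)`. -/
theorem beta_pos {α ω : ℝ} (hω : |eigenvalue α| < ω) : 0 < beta α ω := by
  have hω0 : 0 < ω := (abs_nonneg _).trans_lt hω
  have h1 : |eigenvalue α| = Real.exp (Real.log 4 +
      -2 * (2 * Real.pi * α + Real.eulerMascheroniConstant)) := by
    rw [Real.exp_add, Real.exp_log (by norm_num), eigenvalue, abs_mul, Real.abs_exp]
    norm_num
  rw [h1, ← Real.lt_log_iff_exp_lt hω0, show (4 : ℝ) = 2 ^ 2 by norm_num, Real.log_pow] at hω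
  have h2 : beta α ω = (4 * Real.pi)⁻¹ * (Real.log ω - (((2 : ℕ) : ℝ) * Real.log 2 +
      -2 * (2 * Real.pi * α + Real.eulerMascheroniConstant))) := by
    unfold beta
    rw [Real.log_div (Real.sqrt_pos.2 hω0).ne' two_ne_zero, Real.log_sqrt hω0.le]
    field_simp
    push_cast
    ring
  rw [h2]
  exact mul_pos (by positivity) (by linarith)

theorem memLp_realSymbol {ω : ℝ} (hω : 0 < ω) :
    MemLp (fun ξ => (realSymbol ω ξ : ℂ)) 2 volume := memLp_greenSymbol hω

theorem integrable_realSymbol_mul {ω : ℝ} (hω : 0 < ω) (u : L2) :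
    Integrable (fun ξ => (realSymbol ω ξ : ℂ) * u ξ) :=
  (memLp_realSymbol hω).integrable_mul (Lp.memLp u)

theorem realSymbol_sub_eq {ω ω₀ : ℝ} (hω : 0 < ω) (hω₀ : 0 < ω₀) (ξ : Plane) :
    realSymbol ω ξ - realSymbol ω₀ ξ = (ω₀ - ω) * (realSymbol ω ξ * realSymbol ω₀ ξ) := by
  unfold realSymbol
  have h1 : 0 < ω + (2 * Real.pi * ‖ξ‖) ^ 2 := by positivity
  have h2 : 0 < ω₀ + (2 * Real.pi * ‖ξ‖) ^ 2 := by positivity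
  field_simp
  ring

theorem integrable_realSymbol_sub {ω ω₀ : ℝ} (hω : 0 < ω) (hω₀ : 0 < ω₀) :
    Integrable fun ξ : Plane => realSymbol ω ξ - realSymbol ω₀ ξ := by
  have h := ((memLp_realSymbol hω).integrable_mul (memLp_realSymbol hω₀)).re.const_mul (ω₀ - ω)
  refine h.congr (Filter.Eventually.of_forall fun ξ => ?_)
  simp [realSymbol_sub_eq hω hω₀]

/-- This is the value at `0` of the difference of the Green functions, whose logarithmic
singularities cancel. It equals `β_α(ω₀) - β_α(ω)`, which is why the boundary condition does not
depend on the auxiliary constant. -/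
theorem integral_realSymbol_sub {ω ω₀ : ℝ} (hω : 0 < ω) (hω₀ : 0 < ω₀) :
    ∫ ξ : Plane, (realSymbol ω ξ - realSymbol ω₀ ξ) =
      (4 * Real.pi)⁻¹ * (Real.log ω₀ - Real.log ω) := by
  have hI := integrable_realSymbol_sub hω hω₀
  let g : ℝ → ℝ := fun u => (ω + u)⁻¹ - (ω₀ + u)⁻¹
  have hg : IntegrableOn g (Set.Ioi 0) := integrable_comp_sq_norm.1 hI
  have h1 := integral_comp_sq_norm g
  have h2 : ∫ u in Set.Ioi (0 : ℝ), g u = 0 - (Real.log (ω + 0) - Real.log (ω₀ + 0)) := by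
    refine integral_Ioi_of_hasDerivAt_of_tendsto'
      (f := fun u => Real.log (ω + u) - Real.log (ω₀ + u)) (fun u hu => ?_) hg ?_
    · have hu0 : 0 ≤ u := hu
      have e1 := (((hasDerivAt_id u).const_add ω).log (by simp; positivity)).fun_sub
        (((hasDerivAt_id u).const_add ω₀).log (by simp; positivity))
      simpa [g] using e1
    · have e2 : Filter.Tendsto (fun u : ℝ => Real.log ((ω + u) / (ω₀ + u))) Filter.atTop
          (nhds (Real.log 1)) := by
        refine Filter.Tendsto.log ?_ one_ne_zero
        have e3 : Filter.Tendsto (fun u : ℝ => 1 + (ω - ω₀) / (ω₀ + u)) Filter.atTop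
            (nhds (1 + 0)) :=
          tendsto_const_nhds.add (Filter.Tendsto.div_atTop tendsto_const_nhds
            (Filter.tendsto_atTop_add_const_left _ _ Filter.tendsto_id))
        rw [add_zero] at e3
        refine e3.congr' ?_
        filter_upwards [Filter.eventually_gt_atTop 0] with u hu
        field_simp
        ring
      rw [Real.log_one] at e2
      refine e2.congr' ?_
      filter_upwards [Filter.eventually_gt_atTop 0] with u hu
      rw [Real.log_div (by positivity) (by positivity)]
  rw [h2] at h1
  rw [show (fun ξ : Plane => realSymbol ω ξ - realSymbol ω₀ ξ) =
    fun ξ : Plane => g ((2 * Real.pi * ‖ξ‖) ^ 2) from rfl, h1, smul_eq_mul]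
  simp

theorem fourier_greenFunction {ω : ℝ} (hω : 0 < ω) :
    (𝓕 (greenFunction ω hω) : L2) =ᵐ[volume] fun ξ => (realSymbol ω ξ : ℂ) := by
  rw [greenFunction, FourierTransform.fourier_fourierInv_eq]
  exact (memLp_greenSymbol hω).coeFn_toLp

/-- Pairing with the Green function evaluates `(ω - Δ)⁻¹ y` at `0`. -/
theorem inner_greenFunction {ω : ℝ} (hω : 0 < ω) (y : L2) :
    ⟪greenFunction ω hω, y⟫_ℂ = ∫ ξ, (realSymbol ω ξ : ℂ) * (𝓕 y : L2) ξ := by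
  rw [inner_eq_integral_fourier]
  refine integral_congr_ae ?_
  filter_upwards [fourier_greenFunction hω] with ξ hξ
  rw [hξ, Complex.conj_ofReal]

/-- The resolvent `(ω - Δ)⁻¹` of the free Laplacian. -/
noncomputable def freeResolvent {ω : ℝ} (hω : 0 < ω) : L2 →L[ℂ] L2 :=
  fourierMul (powSymbol hω zero_le_one)

theorem fourier_freeResolvent {ω : ℝ} (hω : 0 < ω) (y : L2) :
    (𝓕 (freeResolvent hω y) : L2) =ᵐ[volume] fun ξ => (realSymbol ω ξ : ℂ) * (𝓕 y : L2) ξ := by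
  filter_upwards [fourier_fourierMul (powSymbol hω zero_le_one) y] with ξ hξ
  rw [freeResolvent, hξ, powSymbol_apply, Real.rpow_one]

/-- The resolvent `(ω - Δ_α)⁻¹`, by Krein's formula. -/
noncomputable def kreinResolvent (α : ℝ) {ω : ℝ} (hω : 0 < ω) : L2 →L[ℂ] L2 :=
  freeResolvent hω + ((beta α ω)⁻¹ : ℂ) •
    InnerProductSpace.rankOne ℂ (greenFunction ω hω) (greenFunction ω hω)

theorem kreinResolvent_apply (α : ℝ) {ω : ℝ} (hω : 0 < ω) (y : L2) :
    kreinResolvent α hω y = freeResolvent hω y +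
      ((beta α ω : ℂ)⁻¹ * ⟪greenFunction ω hω, y⟫_ℂ) • greenFunction ω hω := by
  rw [mul_smul]
  rfl

theorem mem_shifted_graph_iff (α ω₀ : ℝ) (hω₀ : 0 < ω₀) (ω : ℝ) (x y : L2) :
    (x, y) ∈ (shifted α ω₀ hω₀ ω).graph ↔ (x, y - (ω : ℂ) • x) ∈ graph α ω₀ hω₀ := by
  rw [← negLaplacian_graph, LinearPMap.mem_graph_iff, LinearPMap.mem_graph_iff]
  constructor
  · rintro ⟨z, rfl, h⟩
    refine ⟨z, rfl, eq_sub_of_add_eq' ?_⟩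
    exact h
  · rintro ⟨z, rfl, h⟩
    refine ⟨z, rfl, ?_⟩
    exact add_eq_of_eq_sub' h

theorem integral_regular_part {ω ω₀ : ℝ} (hω : 0 < ω) (hω₀ : 0 < ω₀) {f y : L2} {c : ℂ}
    (hf : (𝓕 f : L2) =ᵐ[volume] fun ξ => (realSymbol ω ξ : ℂ) * (𝓕 y : L2) ξ +
      c * (realSymbol ω ξ - realSymbol ω₀ ξ : ℝ)) (α : ℝ) :
    Integrable (𝓕 f : L2) ∧ ∫ ξ, (𝓕 f : L2) ξ =
      ⟪greenFunction ω hω, y⟫_ℂ + c * (beta α ω₀ - beta α ω : ℝ) := by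
  have h1 := integrable_realSymbol_mul hω (𝓕 y : L2)
  have h2 : Integrable fun ξ : Plane => c * ((realSymbol ω ξ - realSymbol ω₀ ξ : ℝ) : ℂ) :=
    (integrable_realSymbol_sub hω hω₀).ofReal.const_mul c
  refine ⟨(h1.add h2).congr hf.symm, ?_⟩
  rw [integral_congr_ae hf, integral_add h1 h2, inner_greenFunction, integral_const_mul,
    integral_complex_ofReal, integral_realSymbol_sub hω hω₀, beta_sub_beta hω hω₀]

/-- Let `x = f + c 𝒢_{ω₀}` with `f(0) = c β(ω₀)`. The equation for `y` says `x = (ω - Δ)⁻¹ y + c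
𝒢_ω`, so `f = (ω - Δ)⁻¹ y + c (𝒢_ω - 𝒢_{ω₀})` and `f(0) = ⟨𝒢_ω, y⟩ + c (β(ω₀) - β(ω))`. The boundary
condition becomes `c β(ω) = ⟨𝒢_ω, y⟩`, which is Krein's formula, and the argument reverses. -/
theorem isBoundedInverse_shifted {α ω₀ : ℝ} (hω₀ : 0 < ω₀) (hβ₀ : beta α ω₀ ≠ 0) {ω : ℝ}
    (hω : 0 < ω) (hβ : beta α ω ≠ 0) :
    (shifted α ω₀ hω₀ ω).IsBoundedInverse (kreinResolvent α hω) := by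
  have hβ' : (beta α ω : ℂ) ≠ 0 := by exact_mod_cast hβ
  have hβ₀' : (beta α ω₀ : ℂ) ≠ 0 := by exact_mod_cast hβ₀
  intro x y
  have hfour : (𝓕 (y - (ω : ℂ) • x + (ω₀ : ℂ) • x) : L2) =ᵐ[volume]
      fun ξ => (𝓕 y : L2) ξ + (ω₀ - ω) * (𝓕 x : L2) ξ := by
    have e : y - (ω : ℂ) • x + (ω₀ : ℂ) • x = y + ((ω₀ : ℂ) - ω) • x := by
      rw [sub_smul]
      abel
    rw [e]
    filter_upwards [fourier_add_ae y (((ω₀ : ℂ) - ω) • x), fourier_smul_ae ((ω₀ : ℂ) - ω) x]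
      with ξ h1 h2
    rw [h1, h2]
  rw [mem_shifted_graph_iff, kreinResolvent_apply]
  constructor
  · rintro ⟨f, F, -, hF, hfF, h1, h2⟩
    rw [toTemperedDistribution_eq_sub_laplacian_iff] at h2
    simp only at h1 h2
    set c : ℂ := F 0 / (beta α ω₀ : ℂ) with hc
    have hx : (𝓕 x : L2) =ᵐ[volume] fun ξ => (𝓕 f : L2) ξ + c * (realSymbol ω₀ ξ : ℂ) := by
      rw [h1]
      filter_upwards [fourier_add_ae f (c • greenFunction ω₀ hω₀),
        fourier_smul_ae c (greenFunction ω₀ hω₀), fourier_greenFunction hω₀] with ξ e1 e2 e3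
      rw [e1, e2, e3]
    have hx' : (𝓕 x : L2) =ᵐ[volume]
        fun ξ => (realSymbol ω ξ : ℂ) * (𝓕 y : L2) ξ + c * (realSymbol ω ξ : ℂ) := by
      filter_upwards [hx, h2, hfour] with ξ e1 e2 e3
      rw [e3] at e2
      have hf : (𝓕 f : L2) ξ = (𝓕 x : L2) ξ - c * (realSymbol ω₀ ξ : ℂ) := by
        rw [e1]
        ring
      rw [hf] at e2
      have p1 : ω + (2 * Real.pi * ‖ξ‖) ^ 2 ≠ 0 := by positivity
      have p2 : ω₀ + (2 * Real.pi * ‖ξ‖) ^ 2 ≠ 0 := by positivity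
      have q1 : ((ω + (2 * Real.pi * ‖ξ‖) ^ 2 : ℝ) : ℂ) * (realSymbol ω ξ : ℂ) = 1 := by
        rw [← Complex.ofReal_mul, realSymbol, mul_inv_cancel₀ p1, Complex.ofReal_one]
      have q2 : ((ω₀ + (2 * Real.pi * ‖ξ‖) ^ 2 : ℝ) : ℂ) * (realSymbol ω₀ ξ : ℂ) = 1 := by
        rw [← Complex.ofReal_mul, realSymbol, mul_inv_cancel₀ p2, Complex.ofReal_one]
      push_cast at e2 q1 q2
      linear_combination (-(𝓕 x : L2) ξ) * q1 - (realSymbol ω ξ : ℂ) * e2 +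
        c * (realSymbol ω ξ : ℂ) * q2
    have hf : (𝓕 f : L2) =ᵐ[volume] fun ξ => (realSymbol ω ξ : ℂ) * (𝓕 y : L2) ξ +
        c * (realSymbol ω ξ - realSymbol ω₀ ξ : ℝ) := by
      filter_upwards [hx, hx'] with ξ e1 e2
      rw [e2] at e1
      push_cast
      linear_combination -e1
    obtain ⟨hfi, hfint⟩ := integral_regular_part hω hω₀ hf α
    have hF0 := continuous_rep_zero hfi hF hfF
    have hcF : c * (beta α ω₀ : ℂ) = F 0 := div_mul_cancel₀ _ hβ₀'
    have hcval : c = (beta α ω : ℂ)⁻¹ * ⟪greenFunction ω hω, y⟫_ℂ := by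
      rw [hfint] at hF0
      rw [hF0] at hcF
      push_cast at hcF
      rw [eq_inv_mul_iff_mul_eq₀ hβ']
      linear_combination hcF
    rw [← hcval]
    refine fourier_injective ?_
    filter_upwards [hx', fourier_add_ae (freeResolvent hω y) (c • greenFunction ω hω),
      fourier_freeResolvent hω y, fourier_smul_ae c (greenFunction ω hω),
      fourier_greenFunction hω] with ξ e1 e2 e3 e4 e5
    rw [e1, e2, e3, e4, e5]
  · set c : ℂ := (beta α ω : ℂ)⁻¹ * ⟪greenFunction ω hω, y⟫_ℂ with hc
    intro hxy
    have hx' : (𝓕 x : L2) =ᵐ[volume]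
        fun ξ => (realSymbol ω ξ : ℂ) * (𝓕 y : L2) ξ + c * (realSymbol ω ξ : ℂ) := by
      rw [hxy]
      filter_upwards [fourier_add_ae (freeResolvent hω y) (c • greenFunction ω hω),
        fourier_freeResolvent hω y, fourier_smul_ae c (greenFunction ω hω),
        fourier_greenFunction hω] with ξ e2 e3 e4 e5
      rw [e2, e3, e4, e5]
    -- The singular part is removed at `ω₀`, not at `ω`, since `graph` is written with `ω₀`; the
    -- coefficient `c` is the same.
    set f : L2 := x + (-c) • greenFunction ω₀ hω₀ with hfdef
    have hf : (𝓕 f : L2) =ᵐ[volume] fun ξ => (realSymbol ω ξ : ℂ) * (𝓕 y : L2) ξ +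
        c * (realSymbol ω ξ - realSymbol ω₀ ξ : ℝ) := by
      filter_upwards [hx', fourier_add_ae x ((-c) • greenFunction ω₀ hω₀),
        fourier_smul_ae (-c) (greenFunction ω₀ hω₀), fourier_greenFunction hω₀] with ξ e1 e2 e3 e4
      rw [hfdef, e2, e1, e3, e4]
      push_cast
      ring
    obtain ⟨hfi, hfint⟩ := integral_regular_part hω hω₀ hf α
    obtain ⟨F, hF, hfF, hF0⟩ := exists_continuous_rep hfi
    have hF0' : F 0 / (beta α ω₀ : ℂ) = c := by
      rw [div_eq_iff hβ₀', hF0, hfint]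
      have : (beta α ω : ℂ) * c = ⟪greenFunction ω hω, y⟫_ℂ := by
        rw [hc, mul_inv_cancel_left₀ hβ']
      rw [← this]
      push_cast
      ring
    have hlap : (𝓕 (y - (ω : ℂ) • x + (ω₀ : ℂ) • x) : L2) =ᵐ[volume]
        fun ξ => ((ω₀ + (2 * Real.pi * ‖ξ‖) ^ 2 : ℝ) : ℂ) * (𝓕 f : L2) ξ := by
      filter_upwards [hfour, hx', hf] with ξ e1 e2 e3
      have p1 : ω + (2 * Real.pi * ‖ξ‖) ^ 2 ≠ 0 := by positivity
      have p2 : ω₀ + (2 * Real.pi * ‖ξ‖) ^ 2 ≠ 0 := by positivity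
      have q1 : ((ω + (2 * Real.pi * ‖ξ‖) ^ 2 : ℝ) : ℂ) * (realSymbol ω ξ : ℂ) = 1 := by
        rw [← Complex.ofReal_mul, realSymbol, mul_inv_cancel₀ p1, Complex.ofReal_one]
      have q2 : ((ω₀ + (2 * Real.pi * ‖ξ‖) ^ 2 : ℝ) : ℂ) * (realSymbol ω₀ ξ : ℂ) = 1 := by
        rw [← Complex.ofReal_mul, realSymbol, mul_inv_cancel₀ p2, Complex.ofReal_one]
      rw [e1, e2, e3]
      push_cast at q1 q2 ⊢
      linear_combination (-(𝓕 y : L2) ξ - c) * q1 + c * q2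
    refine ⟨f, F, ?_, hF, hfF, ?_, ?_⟩
    · rw [memSobolev_iff_exists_fourierMul hω₀ zero_le_two]
      refine ⟨y - (ω : ℂ) • x + (ω₀ : ℂ) • x, Eq.symm ?_⟩
      rw [fourierMul_eq_iff]
      filter_upwards [hlap] with ξ e1
      have p2 : ω₀ + (2 * Real.pi * ‖ξ‖) ^ 2 ≠ 0 := by positivity
      rw [e1, powSymbol_apply, div_self two_ne_zero, Real.rpow_one, ← mul_assoc,
        ← Complex.ofReal_mul, realSymbol, inv_mul_cancel₀ p2, Complex.ofReal_one, one_mul]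
    · rw [hF0', hfdef, neg_smul]
      simp
    · exact (toTemperedDistribution_eq_sub_laplacian_iff ω₀ f _).2 hlap

end PointInteraction

/-! ### Comparison of the fractional powers -/

namespace LinearPMap

variable {H : Type*} [NormedAddCommGroup H] [InnerProductSpace ℂ H] [CompleteSpace H]

theorem IsBoundedInverse.negPow_eq {A : H →ₗ.[ℂ] H} {K : H →L[ℂ] H} (hK : A.IsBoundedInverse K)
    (σ : ℝ) : A.negPow σ = K.posPow σ := by
  rw [negPow, hK.boundedInverse_eq]
  rfl

theorem IsBoundedInverse.fracPow_apply_eq {A : H →ₗ.[ℂ] H} {K : H →L[ℂ] H}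
    (hK : A.IsBoundedInverse K) {σ : ℝ} (hinj : Function.Injective (K.posPow σ))
    (g : (A.fracPow σ).domain) {h : H} (hg : K.posPow σ h = g) : A.fracPow σ g = h := by
  have hker : (((A.negPow σ : H →ₗ[ℂ] H).toPMap ⊤).toFun).ker = ⊥ := by
    refine LinearMap.ker_eq_bot.2 fun x y hxy => ?_
    rw [hK.negPow_eq] at hxy
    exact Subtype.ext (hinj hxy)
  have hg' : A.negPow σ h = g := by rw [hK.negPow_eq, hg]
  exact LinearPMap.inverse_apply_eq hker (y := g) (x := ⟨h, trivial⟩) hg'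

end LinearPMap

namespace PointInteraction

open scoped BoundedContinuousFunction InnerProductSpace

theorem powSymbol_one_apply {ω : ℝ} (hω : 0 < ω) (ξ : Plane) :
    powSymbol hω zero_le_one ξ = (realSymbol ω ξ : ℂ) := by
  rw [powSymbol_apply, Real.rpow_one]

theorem freeResolvent_nonneg {ω : ℝ} (hω : 0 < ω) : 0 ≤ freeResolvent hω :=
  fourierMul_nonneg (powSymbol_one_apply hω) fun ξ => (realSymbol_pos hω ξ).le

theorem freeResolvent_posPow {ω : ℝ} (hω : 0 < ω) {σ : ℝ} (hσ : 0 ≤ σ) :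
    (freeResolvent hω).posPow σ = fourierMul (powSymbol hω hσ) :=
  posPow_fourierMul hσ (powSymbol_one_apply hω) (fun ξ => (realSymbol_pos hω ξ).le)
    (powSymbol_apply hω hσ)

theorem freeResolvent_le_kreinResolvent {α ω : ℝ} (hω : 0 < ω) (hβ : 0 < beta α ω) :
    freeResolvent hω ≤ kreinResolvent α hω := by
  rw [ContinuousLinearMap.le_def, kreinResolvent, add_sub_cancel_left]
  refine (InnerProductSpace.isPositive_rankOne_self _).smul_of_nonneg ?_
  rw [← Complex.ofReal_inv]
  exact_mod_cast (inv_pos.2 hβ).le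

theorem injective_fourierMul_powSymbol {ω : ℝ} (hω : 0 < ω) {σ : ℝ} (hσ : 0 ≤ σ) :
    Function.Injective (fourierMul (powSymbol hω hσ)) := by
  intro u v huv
  refine fourier_injective ?_
  have h := fourier_fourierMul (powSymbol hω hσ) u
  rw [huv] at h
  filter_upwards [h, fourier_fourierMul (powSymbol hω hσ) v] with ξ h1 h2
  rw [h1, powSymbol_apply] at h2
  have hm : ((realSymbol ω ξ ^ σ : ℝ) : ℂ) ≠ 0 := by
    have := realSymbol_pos hω ξ
    exact_mod_cast (by positivity : realSymbol ω ξ ^ σ ≠ 0)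
  exact mul_left_cancel₀ hm h2

/-- The symbol of the resolvent of `(ω - Δ)⁻¹`. -/
noncomputable def resolventSymbol {ω : ℝ} (hω : 0 < ω) {t : ℝ} (ht : 0 < t) : Plane →ᵇ ℂ :=
  BoundedContinuousFunction.ofNormedAddCommGroup (fun ξ => (((t + realSymbol ω ξ)⁻¹ : ℝ) : ℂ))
    (Complex.continuous_ofReal.comp (Continuous.inv₀
      (continuous_const.add (continuous_realSymbol hω))
      fun ξ => (add_pos ht (realSymbol_pos hω ξ)).ne'))
    t⁻¹ fun ξ => by
      have h := realSymbol_pos hω ξ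
      rw [Complex.norm_real, Real.norm_of_nonneg (by positivity)]
      gcongr
      linarith

theorem resolventSymbol_apply {ω : ℝ} (hω : 0 < ω) {t : ℝ} (ht : 0 < t) (ξ : Plane) :
    resolventSymbol hω ht ξ = (((t + realSymbol ω ξ)⁻¹ : ℝ) : ℂ) := rfl

theorem fourierMul_resolventSymbol_mul {ω : ℝ} (hω : 0 < ω) {t : ℝ} (ht : 0 < t) :
    fourierMul (resolventSymbol hω ht) * ((t : ℂ) • 1 + freeResolvent hω) = 1 := by
  have h1 : (t : ℂ) • (1 : L2 →L[ℂ] L2) + freeResolvent hω =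
      fourierMulHom ((t : ℂ) • 1 + powSymbol hω zero_le_one) := by
    rw [map_add, map_smul, map_one]
    rfl
  have h2 : resolventSymbol hω ht * ((t : ℂ) • 1 + powSymbol hω zero_le_one) = 1 := by
    ext ξ
    have h := realSymbol_pos hω ξ
    have h3 : ((t + realSymbol ω ξ : ℝ) : ℂ) ≠ 0 := by
      exact_mod_cast (by positivity : t + realSymbol ω ξ ≠ 0)
    rw [BoundedContinuousFunction.mul_apply, BoundedContinuousFunction.add_apply,
      powSymbol_one_apply, resolventSymbol_apply, BoundedContinuousFunction.smul_apply,
      BoundedContinuousFunction.coe_one, Pi.one_apply, smul_eq_mul, mul_one, ← Complex.ofReal_add,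
      Complex.ofReal_inv, inv_mul_cancel₀ h3]
  rw [h1, ← fourierMulHom_apply, ← map_mul, h2, map_one]

/-- Produces the kernel `m / (t + m)` of `exists_schur_bound`; absolute values may be taken inside
because that test involves no cancellation. -/
theorem enorm_inner_greenFunction_le {ω : ℝ} (hω : 0 < ω) {t : ℝ} (ht : 0 < t) (x : L2) :
    ‖⟪greenFunction ω hω, fourierMul (resolventSymbol hω ht) x⟫_ℂ‖ₑ ≤
      ∫⁻ ξ, ENNReal.ofReal (realSymbol ω ξ / (t + realSymbol ω ξ)) * ‖(𝓕 x : L2) ξ‖ₑ := by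
  rw [inner_greenFunction]
  refine (enorm_integral_le_lintegral_enorm _).trans (le_of_eq ?_)
  refine lintegral_congr_ae ?_
  filter_upwards [fourier_fourierMul (resolventSymbol hω ht) x] with ξ hξ
  have h := realSymbol_pos hω ξ
  rw [hξ, resolventSymbol_apply, ← mul_assoc, ← Complex.ofReal_mul, enorm_mul,
    ← ofReal_norm, Complex.norm_real, Real.norm_of_nonneg (by positivity), div_eq_mul_inv]

theorem lintegral_realSymbol_rpow {ω : ℝ} (hω : 0 < ω) {s : ℝ} (hs : 0 ≤ s) (x : L2) :
    ∫⁻ ξ, ENNReal.ofReal (realSymbol ω ξ ^ s) * ‖(𝓕 x : L2) ξ‖ₑ ^ 2 =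
      ENNReal.ofReal (‖(freeResolvent hω).posPow (s / 2) x‖ ^ 2) := by
  have hs2 : 0 ≤ s / 2 := div_nonneg hs zero_le_two
  rw [freeResolvent_posPow hω hs2, norm_sq_eq_integral_fourier,
    ofReal_integral_eq_lintegral_ofReal]
  · refine lintegral_congr_ae ?_
    filter_upwards [fourier_fourierMul (powSymbol hω hs2) x] with ξ hξ
    have hm := realSymbol_pos hω ξ
    rw [hξ, powSymbol_apply, norm_mul, Complex.norm_real, Real.norm_of_nonneg (by positivity),
      mul_pow, ENNReal.ofReal_mul (by positivity), ← Real.rpow_mul_natCast hm.le,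
      ENNReal.ofReal_pow (norm_nonneg _), ofReal_norm]
    norm_num
  · exact (memLp_two_iff_integrable_sq_norm (Lp.aestronglyMeasurable _)).1 (Lp.memLp _)
  · exact Filter.Eventually.of_forall fun ξ => by positivity

/-- The rank one perturbation does not change the form domains of the powers of order less than
one half. -/
theorem exists_norm_kreinResolvent_posPow_le {α ω : ℝ} (hω : 0 < ω) (hβ : 0 < beta α ω) {s : ℝ}
    (hs₀ : 0 ≤ s) (hs₁ : s < 1) : ∃ C, 0 < C ∧ ∀ x : L2,
      ‖(kreinResolvent α hω).posPow (s / 2) x‖ ≤ C * ‖(freeResolvent hω).posPow (s / 2) x‖ := by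
  have hR := freeResolvent_nonneg hω
  have hK : 0 ≤ kreinResolvent α hω := hR.trans (freeResolvent_le_kreinResolvent hω hβ)
  -- The integral representation needs a positive exponent; for `s = 0` both powers are the
  -- identity.
  rcases hs₀.eq_or_lt with rfl | hs
  · refine ⟨1, one_pos, fun x => ?_⟩
    rw [zero_div, ContinuousLinearMap.posPow_zero hR, ContinuousLinearMap.posPow_zero hK, one_mul]
  have hp : s ∈ Set.Ioo (0 : ℝ) 1 := ⟨hs, hs₁⟩
  obtain ⟨C, hC, hCb⟩ := exists_schur_bound hω hp
  set b := (beta α ω)⁻¹ with hb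
  have hb0 : 0 < b := inv_pos.2 hβ
  set c := (∫ t in Set.Ioi 0, Real.rpowIntegrand₀₁ s t 1)⁻¹ with hc
  have hc0 : 0 < c := inv_pos.2 (Real.integral_rpowIntegrand₀₁_one_pos hp)
  -- `resolventSymbol` takes a proof of `0 < t`, so the family is extended to all real `t`, by `0`
  -- elsewhere.
  have hresolvent : ∀ t : ℝ, ∃ r : L2 →L[ℂ] L2, ∀ ht : 0 < t,
      r = fourierMul (resolventSymbol hω ht) := fun t => by
    by_cases ht : 0 < t
    · exact ⟨fourierMul (resolventSymbol hω ht), fun _ => rfl⟩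
    · exact ⟨0, fun h => absurd h ht⟩
  choose r hr using hresolvent
  refine ⟨Real.sqrt (1 + c * (b * C)), by positivity, fun x => ?_⟩
  set N := ‖(freeResolvent hω).posPow (s / 2) x‖ with hN
  have hform : ∀ v : L2, (⟪v, (kreinResolvent α hω - freeResolvent hω) v⟫_ℂ).re =
      b * ‖⟪greenFunction ω hω, v⟫_ℂ‖ ^ 2 := fun v => by
    rw [sub_apply, kreinResolvent_apply, add_sub_cancel_left, inner_smul_right, mul_assoc,
      ← inner_conj_symm v, Complex.mul_conj, Complex.normSq_eq_norm_sq, ← Complex.ofReal_inv,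
      ← Complex.ofReal_mul, Complex.ofReal_re]
  have hbound : ∫⁻ t in Set.Ioi (0 : ℝ), ENNReal.ofReal (t ^ s *
      (⟪r t x, (kreinResolvent α hω - freeResolvent hω) (r t x)⟫_ℂ).re) ≤
      ENNReal.ofReal (b * C * N ^ 2) := by
    calc _ ≤ ∫⁻ t in Set.Ioi (0 : ℝ), ENNReal.ofReal b * (ENNReal.ofReal (t ^ s) *
          (∫⁻ ξ, ENNReal.ofReal (realSymbol ω ξ / (t + realSymbol ω ξ)) *
            ‖(𝓕 x : L2) ξ‖ₑ) ^ 2) := by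
          refine setLIntegral_mono' measurableSet_Ioi fun t ht => ?_
          have ht0 : 0 < t := ht
          rw [hform, hr t ht0, mul_left_comm, ENNReal.ofReal_mul hb0.le,
            ENNReal.ofReal_mul (by positivity), ENNReal.ofReal_pow (norm_nonneg _), ofReal_norm]
          gcongr
          exact enorm_inner_greenFunction_le hω ht0 x
      _ ≤ ENNReal.ofReal b * (ENNReal.ofReal C * ENNReal.ofReal (N ^ 2)) := by
          rw [lintegral_const_mul' _ _ ENNReal.ofReal_ne_top, hN,
            ← lintegral_realSymbol_rpow hω hs₀]
          gcongr
          exact hCb _ (Lp.aestronglyMeasurable _).enorm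
      _ = _ := by
          rw [ENNReal.ofReal_mul (by positivity), ENNReal.ofReal_mul hb0.le, mul_assoc]
  have key := ContinuousLinearMap.re_inner_posPow_le hp hR hK (r := r)
    (fun t ht => by rw [hr t ht]; exact fourierMul_resolventSymbol_mul hω ht) x
    (by positivity) hbound
  rw [← ContinuousLinearMap.norm_posPow_half_sq hK hs₀,
    ← ContinuousLinearMap.norm_posPow_half_sq hR hs₀, ← hN] at key
  refine le_of_sq_le_sq ?_ (by positivity)
  rw [mul_pow, Real.sq_sqrt (by positivity)]
  refine key.trans (le_of_eq ?_)
  ring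

/-- Löwner–Heinz applied to `R ≤ K` with exponent `s ≤ 1`. -/
theorem norm_freeResolvent_posPow_le {α ω : ℝ} (hω : 0 < ω) (hβ : 0 < beta α ω) {s : ℝ}
    (hs₀ : 0 ≤ s) (hs₁ : s < 1) (x : L2) :
    ‖(freeResolvent hω).posPow (s / 2) x‖ ≤ ‖(kreinResolvent α hω).posPow (s / 2) x‖ := by
  have hR := freeResolvent_nonneg hω
  have hle := freeResolvent_le_kreinResolvent hω hβ
  refine le_of_sq_le_sq ?_ (norm_nonneg _)
  rw [ContinuousLinearMap.norm_posPow_half_sq hR hs₀,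
    ContinuousLinearMap.norm_posPow_half_sq (hR.trans hle) hs₀]
  exact ContinuousLinearMap.re_inner_le_of_le
    (ContinuousLinearMap.posPow_mono ⟨hs₀, hs₁.le⟩ hle) x

end PointInteraction

theorem proposition2p3 (α s : ℝ) (hs₀ : 0 ≤ s) (hs₁ : s < 1)
    (ω₀ : ℝ) (hω₀ : 0 < ω₀) (hβ : beta α ω₀ ≠ 0)
    (ω : ℝ) (hω : |eigenvalue α| < ω) :
    {u : 𝓢'(Plane, ℂ) | MemSobolev s 2 u} =
        {u : 𝓢'(Plane, ℂ) | ∃ g ∈ perturbedSobolev α ω₀ hω₀ ω s, u = (g : 𝓢'(Plane, ℂ))} ∧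
      ∃ c C : ℝ, 0 < c ∧ 0 < C ∧ ∀ g : perturbedSobolev α ω₀ hω₀ ω s,
        c * sobolevNorm s g ≤ perturbedNorm α ω₀ hω₀ ω s g ∧
          perturbedNorm α ω₀ hω₀ ω s g ≤ C * sobolevNorm s g := by
  have hω' : 0 < ω := (abs_nonneg _).trans_lt hω
  have hβω : 0 < beta α ω := beta_pos hω
  have hs2 : 0 ≤ s / 2 := div_nonneg hs₀ zero_le_two
  have hinv := isBoundedInverse_shifted hω₀ hβ hω' hβω.ne'
  set S := (freeResolvent hω').posPow (s / 2) with hS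
  set T := (kreinResolvent α hω').posPow (s / 2) with hT
  have hSeq : S = fourierMul (powSymbol hω' hs2) := freeResolvent_posPow hω' hs2
  have hSsa : IsSelfAdjoint S := ContinuousLinearMap.isSelfAdjoint_posPow _ _
  have hTsa : IsSelfAdjoint T := ContinuousLinearMap.isSelfAdjoint_posPow _ _
  have hSinj : Function.Injective S := hSeq ▸ injective_fourierMul_powSymbol hω' hs2
  have hST : ∀ x, ‖S x‖ ≤ 1 * ‖T x‖ := fun x => by
    rw [one_mul]
    exact norm_freeResolvent_posPow_le hω' hβω hs₀ hs₁ x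
  obtain ⟨B, hB, hTS⟩ := exists_norm_kreinResolvent_posPow_le (α := α) hω' hβω hs₀ hs₁
  have hTinj : Function.Injective T := by
    refine (injective_iff_map_eq_zero T).2 fun x hx => (injective_iff_map_eq_zero S).1 hSinj x ?_
    have := hST x
    rw [hx, norm_zero, mul_zero] at this
    exact norm_le_zero_iff.1 this
  have hmem : ∀ g : L2, g ∈ perturbedSobolev α ω₀ hω₀ ω s ↔ ∃ h, T h = g := fun g => by
    rw [perturbedSobolev, LinearPMap.mem_fracPow_domain_iff, hinv.negPow_eq]
  -- The two range inclusions, with bounds on the preimages: `B` from the Schur test, `1` from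
  -- Löwner–Heinz.
  have hfac := ContinuousLinearMap.exists_apply_eq_of_norm_apply_le hSsa hTsa hSinj hB.le hTS
  have hfac' := ContinuousLinearMap.exists_apply_eq_of_norm_apply_le hTsa hSsa hTinj zero_le_one hST
  have hsob : ∀ g : L2, MemSobolev s 2 (g : 𝓢'(Plane, ℂ)) ↔ ∃ h, S h = g := fun g => by
    rw [memSobolev_iff_exists_fourierMul hω' hs₀, hSeq]
  refine ⟨?_, ?_⟩
  · ext u
    constructor
    · intro hu
      -- A priori `u` is only a tempered distribution; `0 ≤ s` makes it an `L²` function.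
      obtain ⟨g, rfl⟩ := memSobolev_zero_iff.1 (MemSobolev.mono hs₀ hu)
      obtain ⟨h, rfl⟩ := (hsob g).1 hu
      obtain ⟨k, hk, -⟩ := hfac' h
      exact ⟨S h, (hmem _).2 ⟨k, hk⟩, rfl⟩
    · rintro ⟨g, hg, rfl⟩
      obtain ⟨h, rfl⟩ := (hmem g).1 hg
      obtain ⟨k, hk, -⟩ := hfac h
      exact (hsob _).2 ⟨k, hk⟩
  · obtain ⟨D, hD, hDb⟩ := exists_sobolevNorm_comparable hω' hs₀
    rw [← hSeq] at hDb
    refine ⟨(D * B)⁻¹, D, by positivity, hD, fun g => ?_⟩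
    obtain ⟨h, hh⟩ := (hmem g).1 g.2
    have hnorm : perturbedNorm α ω₀ hω₀ ω s g = ‖h‖ := by
      rw [perturbedNorm, hinv.fracPow_apply_eq hTinj g hh]
    -- Here `g = T h = S k`. The inclusions give `‖k‖ ≤ B ‖h‖` and, as `T` is injective, `‖h‖ ≤
    -- ‖k‖`; the Sobolev norm of `g` is comparable to `‖k‖` with constant `D`.
    obtain ⟨k, hk, hkn⟩ := hfac h
    obtain ⟨h', hh', hhn⟩ := hfac' k
    have hhh : h' = h := hTinj (hh'.trans hk)
    rw [hhh, one_mul] at hhn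
    rw [hh] at hk
    have hDk := hDb k
    rw [hk] at hDk
    rw [hnorm]
    constructor
    · rw [inv_mul_le_iff₀ (by positivity), mul_assoc]
      exact hDk.1.trans (by gcongr)
    · exact hhn.trans hDk.2
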